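/- For $\lambda>0$ let $(X_r)_{r\ge 0}$ be the Galton--Watson branching process that starts with a single particle in generation $0$ and in which every particle independently has a Poisson($\lambda$) number of children; $|X_r|$ denotes the size of generation $r$, and the process survives if $|X_r|>0$ for all $r$. For $\lambda>1$ let $\lambda_*<1$ be the unique solution of $\lambda_* e^{-\lambda_*}=\lambda e^{-\lambda}$. For $M>0$ let $t_M=\min\{r: |X_r|\ge M\}$ whenever such an $r$ exists; the event $\{t_M>x\}$ means that $t_M$ is defined and exceeds $x$. Let $\lambda=1+\varepsilon$, and suppose that the real sequences $\varepsilon=\varepsilon(n)>0$, $\omega=\omega(n)$ and $t=t(n)$ satisfy, as $n\to\infty$, $\varepsilon\to 0$, $\omega\to\infty$, $t\le 100\log\omega/\log\lambda$ (for all large $n$) and $\varepsilon t\to\infty$. Put $t_1=\log\omega/\log\lambda$. Then, as $n\to\infty$, $$\Pr\bigl(t_{\omega/\varepsilon}>t_1+t\bigr)\sim 4\varepsilon\lambda_*^{t},$$ $$\Pr\bigl(0<|X_r|<\omega/\varepsilon \text{ for all integers } 0\le r\le t_1+t\bigr)\sim 4\varepsilon\lambda_*^{t},$$ $$\Pr\bigl(0<|X_{t_1+t}|<\omega/\varepsilon\bigr)\sim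 4\varepsilon\lambda_*^{t},$$ $$\Pr\bigl((X_r)\text{ survives and }0<|X_{t_1+t}|<\omega/\varepsilon\bigr)\sim 4\varepsilon\lambda_*^{t},$$ where in the last two lines the index $t_1+t$, if it is not an integer, may be rounded down or up (for each $n$ in either way). -/

import Mathlib

open Filter Topology Asymptotics MeasureTheory ProbabilityTheory

noncomputable section

/-- The generation sizes `|X_0|, |X_1|, …` of the Galton–Watson process started from one particle,
as a function of the family of numbers of children: the `i`-th particle of generation `r`
has `ξ (r, i)` children. -/
def genSize (ξ : ℕ × ℕ → ℕ) : ℕ → ℕ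
  | 0 => 1
  | r + 1 => ∑ i ∈ Finset.range (genSize ξ r), ξ (r, i)

/-- The probability space of the Poisson Galton–Watson process with parameter `lam`:
the numbers of children are independent, each with the Poisson distribution of mean `lam`. -/
def poissonGW (lam : ℝ) : Measure (ℕ × ℕ → ℕ) :=
  Measure.infinitePi (fun _ : ℕ × ℕ => poissonMeasure lam.toNNReal)

instance (lam : ℝ) : IsProbabilityMeasure (poissonGW lam) := by
  unfold poissonGW; infer_instance

/-- `T = min {r : |X_r| ≥ M}`; the minimum need not exist, and then the statement fails for
every `T`. -/
def IsFirstPassage (ξ : ℕ × ℕ → ℕ) (M : ℝ) (T : ℕ) : Prop :=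
  IsLeast {r : ℕ | M ≤ (genSize ξ r : ℝ)} T

/-- The process survives: no generation is empty. -/
def Survives (ξ : ℕ × ℕ → ℕ) : Prop := ∀ r : ℕ, 0 < genSize ξ r

/-- The defining property of the dual parameter of `lam`. -/
def IsDual (lam x : ℝ) : Prop := x < 1 ∧ x * Real.exp (-x) = lam * Real.exp (-lam)

/-- The dual parameter: the `x < 1` with `x e^{-x} = lam e^{-lam}`
(see `existsUnique_isDual`; it is used for `lam > 1` only). -/
def dualParam (lam : ℝ) : ℝ := Classical.epsilon (IsDual lam)

theorem existsUnique_isDual {lam : ℝ} (h : 1 < lam) : ∃! x, IsDual lam x := by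
  have mono : ∀ x y : ℝ, x < y → y < 1 → x * Real.exp (-x) < y * Real.exp (-y) := by
    intro x y hxy hy
    rcases le_or_gt 0 y with h0 | h0
    · have h1 : x < y * Real.exp (x - y) := by
        have := mul_le_mul_of_nonneg_left (Real.add_one_le_exp (x - y)) h0
        nlinarith [mul_pos (sub_pos.2 hxy) (sub_pos.2 hy)]
      have h2 : Real.exp (-y) = Real.exp (x - y) * Real.exp (-x) := by
        rw [← Real.exp_add]; ring_nf
      rw [h2, ← mul_assoc]
      exact mul_lt_mul_of_pos_right h1 (Real.exp_pos _)
    · have h1 : Real.exp (-y) < Real.exp (-x) := Real.exp_lt_exp.2 (by linarith)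
      nlinarith [Real.exp_pos (-x)]
  have hlt : lam * Real.exp (-lam) < 1 * Real.exp (-1) := by
    have h1 : lam < Real.exp (lam - 1) := by
      have := Real.add_one_lt_exp (x := lam - 1) (by linarith)
      linarith
    have h2 : Real.exp (-1) = Real.exp (lam - 1) * Real.exp (-lam) := by
      rw [← Real.exp_add]; ring_nf
    rw [h2, one_mul]
    exact mul_lt_mul_of_pos_right h1 (Real.exp_pos _)
  have hpos : 0 < lam * Real.exp (-lam) := by positivity
  have hc : ContinuousOn (fun x : ℝ => x * Real.exp (-x)) (Set.Icc 0 1) := by fun_prop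
  obtain ⟨x, hx, hxe⟩ := intermediate_value_Icc (zero_le_one' ℝ) hc
    (show lam * Real.exp (-lam) ∈ _ from ⟨by simpa using hpos.le, hlt.le⟩)
  have hx1 : x < 1 := by
    refine lt_of_le_of_ne hx.2 ?_
    rintro rfl
    exact hlt.ne hxe.symm
  refine ⟨x, ⟨hx1, hxe⟩, ?_⟩
  rintro y ⟨hy1, hye⟩
  rcases lt_trichotomy y x with hlt' | heq | hgt
  · have := mono y x hlt' hx1
    simp only at hxe
    linarith
  · exact heq
  · have := mono x y hgt hy1
    simp only at hxe
    linarith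

theorem isDual_dualParam {lam : ℝ} (h : 1 < lam) : IsDual lam (dualParam lam) :=
  Classical.epsilon_spec (existsUnique_isDual h).exists

end

noncomputable section

/-! ### Generating functions of the generation sizes -/

/-- The probability generating function of the Poisson distribution of mean `lam`. -/
def poissonPGF (lam s : ℝ) : ℝ := Real.exp (lam * (s - 1))

/-- The information on the generations before generation `r`. -/
abbrev generationFiltration (r : ℕ) : MeasurableSpace (ℕ × ℕ → ℕ) :=
  ⨆ p ∈ {p : ℕ × ℕ | p.1 < r}, MeasurableSpace.comap (fun ξ : ℕ × ℕ → ℕ => ξ p) inferInstance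

theorem generationFiltration_le (r : ℕ) :
    generationFiltration r ≤ (inferInstance : MeasurableSpace (ℕ × ℕ → ℕ)) :=
  iSup₂_le fun p _ => (measurable_pi_apply p).comap_le

theorem generationFiltration_mono : Monotone generationFiltration := fun _ _ h =>
  iSup₂_le fun p hp => le_iSup₂_of_le p (lt_of_lt_of_le hp h) le_rfl

theorem measurable_eval_generationFiltration {r : ℕ} {p : ℕ × ℕ} (h : p.1 < r) :
    Measurable[generationFiltration r] (fun ξ : ℕ × ℕ → ℕ => ξ p) :=
  measurable_iff_comap_le.2 (le_iSup₂_of_le p h le_rfl)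

theorem measurable_apply_nat {Ω : Type*} [MeasurableSpace Ω] {N : Ω → ℕ} {g : ℕ → Ω → ℕ}
    (hN : Measurable N) (hg : ∀ n, Measurable (g n)) : Measurable fun x => g (N x) x := by
  refine measurable_to_countable' fun k => ?_
  have : (fun x => g (N x) x) ⁻¹' {k} = ⋃ n, (N ⁻¹' {n} ∩ g n ⁻¹' {k}) := by
    ext x; simp
  rw [this]
  exact MeasurableSet.iUnion fun n =>
    (hN (measurableSet_singleton n)).inter (hg n (measurableSet_singleton k))

theorem measurable_genSize_generationFiltration (r : ℕ) :
    Measurable[generationFiltration r] (fun ξ => genSize ξ r) := by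
  induction r with
  | zero => exact @measurable_const _ _ _ (generationFiltration 0) 1
  | succ r ih =>
    refine @measurable_apply_nat _ (generationFiltration (r + 1)) (fun ξ => genSize ξ r)
      (fun n ξ => ∑ i ∈ Finset.range n, ξ (r, i))
      (ih.mono (generationFiltration_mono r.le_succ) le_rfl) fun n => ?_
    exact Finset.measurable_fun_sum _ fun i _ =>
      measurable_eval_generationFiltration (show (r, i).1 < r + 1 from r.lt_succ_self)

@[fun_prop]
theorem measurable_genSize (r : ℕ) : Measurable (fun ξ => genSize ξ r) :=
  (measurable_genSize_generationFiltration r).mono (generationFiltration_le r) le_rfl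

theorem measurableSet_genSize (r : ℕ) (S : Set ℕ) :
    MeasurableSet {ξ : ℕ × ℕ → ℕ | genSize ξ r ∈ S} :=
  measurable_genSize r (MeasurableSet.of_discrete (s := S))

theorem iIndepFun_poissonGW (lam : ℝ) :
    iIndepFun (fun (p : ℕ × ℕ) (ξ : ℕ × ℕ → ℕ) => ξ p) (poissonGW lam) :=
  iIndepFun_infinitePi (X := fun _ (x : ℕ) => x) fun _ => measurable_id

theorem integral_pow_poissonMeasure {lam : ℝ} (hlam : 0 ≤ lam) (s : ℝ) :
    ∫ n, s ^ n ∂(poissonMeasure lam.toNNReal) = poissonPGF lam s := by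
  rw [integral_poissonMeasure, poissonPGF]
  have h := (NormedSpace.expSeries_div_hasSum_exp (lam * s)).mul_left (Real.exp (-lam))
  rw [← Real.exp_eq_exp_ℝ, ← Real.exp_add] at h
  rw [show lam * (s - 1) = -lam + lam * s by ring, ← h.tsum_eq]
  refine tsum_congr fun n => ?_
  rw [Real.coe_toNNReal _ hlam, smul_eq_mul, mul_pow]
  ring

theorem integral_pow_sum_row {lam : ℝ} (hlam : 0 ≤ lam) (s : ℝ) (r k : ℕ) :
    ∫ ξ, s ^ (∑ i ∈ Finset.range k, ξ (r, i)) ∂(poissonGW lam) = poissonPGF lam s ^ k := by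
  have hind : iIndepFun (fun (i : Fin k) (ξ : ℕ × ℕ → ℕ) => ξ (r, (i : ℕ))) (poissonGW lam) :=
    (iIndepFun_poissonGW lam).precomp (g := fun i : Fin k => (r, (i : ℕ)))
      fun i j h => Fin.ext (by simpa using h)
  have h := hind.integral_fun_prod_comp (f := fun _ (n : ℕ) => s ^ n)
    (fun i => (measurable_pi_apply _).aemeasurable)
    (fun i => (measurable_from_nat).aestronglyMeasurable)
  have h1 : ∀ i : Fin k, ∫ ξ, s ^ (ξ (r, (i : ℕ))) ∂(poissonGW lam) = poissonPGF lam s := by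
    intro i
    rw [← integral_pow_poissonMeasure hlam,
      ← Measure.infinitePi_map_eval (fun _ : ℕ × ℕ => poissonMeasure lam.toNNReal) (r, (i : ℕ)),
      integral_map (measurable_pi_apply _).aemeasurable (measurable_from_nat).aestronglyMeasurable]
    rfl
  simp_rw [h1] at h
  simp only [Finset.prod_const, Finset.card_univ, Fintype.card_fin] at h
  rw [← h]
  congr with ξ
  rw [← Finset.prod_pow_eq_pow_sum, Finset.prod_range]

theorem indep_generationFiltration_row (lam : ℝ) (r : ℕ) :
    Indep (generationFiltration r)
      (MeasurableSpace.comap (fun (ξ : ℕ × ℕ → ℕ) (i : ℕ) => ξ (r, i)) inferInstance)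
      (poissonGW lam) := by
  have h := indep_iSup_of_disjoint (fun p : ℕ × ℕ => (measurable_pi_apply p).comap_le)
    (iIndepFun_poissonGW lam).iIndep (S := {p | p.1 < r}) (T := {p | p.1 = r})
    (Set.disjoint_left.2 fun p h1 h2 => (ne_of_lt h1) h2)
  refine indep_of_indep_of_le_right h ?_
  rw [← measurable_iff_comap_le]
  refine @measurable_pi_lambda _ _ _ (_) _ _ fun i => ?_
  exact measurable_iff_comap_le.2 (le_iSup₂_of_le (r, i) rfl le_rfl)

theorem integrable_pow_genSize (lam : ℝ) {s : ℝ} (h0 : 0 ≤ s) (h1 : s ≤ 1) (r : ℕ) :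
    Integrable (fun ξ => s ^ genSize ξ r) (poissonGW lam) := by
  refine Integrable.of_bound (C := 1)
    ((measurable_from_nat (f := fun n => s ^ n)).comp
      (measurable_genSize r)).aestronglyMeasurable (ae_of_all _ fun ξ => ?_)
  rw [Real.norm_of_nonneg (by positivity)]
  exact pow_le_one₀ h0 h1

theorem poissonPGF_nonneg (lam s : ℝ) : 0 ≤ poissonPGF lam s := (Real.exp_pos _).le

theorem poissonPGF_le_one {lam s : ℝ} (hlam : 0 ≤ lam) (hs : s ≤ 1) : poissonPGF lam s ≤ 1 :=
  Real.exp_le_one_iff.2 (mul_nonpos_of_nonneg_of_nonpos hlam (by linarith))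

theorem setIntegral_pow_genSize_succ {lam : ℝ} (hlam : 0 ≤ lam) {s : ℝ} (h0 : 0 ≤ s) (h1 : s ≤ 1)
    (r : ℕ) {A : Set (ℕ × ℕ → ℕ)} (hA : MeasurableSet[generationFiltration r] A) :
    ∫ ξ in A, s ^ genSize ξ (r + 1) ∂(poissonGW lam) =
      ∫ ξ in A, poissonPGF lam s ^ genSize ξ r ∂(poissonGW lam) := by
  set B : ℕ → Set (ℕ × ℕ → ℕ) := fun k => A ∩ {ξ | genSize ξ r = k} with hB
  have hBm : ∀ k, MeasurableSet[generationFiltration r] (B k) := fun k =>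
    hA.inter (measurable_genSize_generationFiltration r (measurableSet_singleton k))
  have hBm' : ∀ k, MeasurableSet (B k) := fun k => generationFiltration_le r _ (hBm k)
  have hU : ⋃ k, B k = A := by ext ξ; simp [hB]
  have hd : Pairwise (Function.onFun Disjoint B) := fun i j hij =>
    Set.disjoint_left.2 fun ξ hi hj => hij (hi.2.symm.trans hj.2)
  have e1 := integral_iUnion hBm' hd
    (integrable_pow_genSize lam h0 h1 (r + 1)).integrableOn
  have e2 := integral_iUnion hBm' hd
    (integrable_pow_genSize lam (poissonPGF_nonneg lam s) (poissonPGF_le_one hlam h1)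
      r).integrableOn
  rw [hU] at e1 e2
  rw [e1, e2]
  refine tsum_congr fun k => ?_
  have l : ∫ ξ in B k, s ^ genSize ξ (r + 1) ∂(poissonGW lam) =
      ∫ ξ in B k, s ^ (∑ i ∈ Finset.range k, ξ (r, i)) ∂(poissonGW lam) :=
    setIntegral_congr_fun (hBm' k) fun ξ hξ => by
      simp only [genSize]; rw [show genSize ξ r = k from hξ.2]
  have l2 : ∫ ξ in B k, poissonPGF lam s ^ genSize ξ r ∂(poissonGW lam) =
      ∫ _ in B k, poissonPGF lam s ^ k ∂(poissonGW lam) :=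
    setIntegral_congr_fun (hBm' k) fun ξ hξ => by
      rw [show genSize ξ r = k from hξ.2]
  rw [l, l2]
  have := (indep_generationFiltration_row lam r).setIntegral_eq_mul (generationFiltration_le r)
    (f := fun v : ℕ → ℕ => s ^ (∑ i ∈ Finset.range k, v i))
    (measurable_pi_lambda _ fun i => measurable_pi_apply _).aemeasurable (hBm k)
    ((measurable_from_nat (f := fun n => s ^ n)).comp
      (Finset.measurable_fun_sum _ fun i _ => measurable_pi_apply i)).aestronglyMeasurable
  rw [this, integral_pow_sum_row hlam, setIntegral_const, smul_eq_mul]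

theorem integral_pow_genSize {lam : ℝ} (hlam : 0 ≤ lam) (r : ℕ) {s : ℝ} (h0 : 0 ≤ s)
    (h1 : s ≤ 1) :
    ∫ ξ, s ^ genSize ξ r ∂(poissonGW lam) = (poissonPGF lam)^[r] s := by
  induction r generalizing s with
  | zero => simp [genSize]
  | succ r ih =>
    have := setIntegral_pow_genSize_succ hlam h0 h1 r (A := Set.univ) MeasurableSet.univ
    rw [setIntegral_univ, setIntegral_univ] at this
    rw [this, ih (poissonPGF_nonneg lam s) (poissonPGF_le_one hlam h1),
      Function.iterate_succ_apply]

theorem measureReal_genSize_eq_zero {lam : ℝ} (hlam : 0 ≤ lam) (r : ℕ) :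
    (poissonGW lam).real {ξ | genSize ξ r = 0} = (poissonPGF lam)^[r] 0 := by
  rw [← integral_pow_genSize hlam r le_rfl zero_le_one,
    ← integral_indicator_one (show MeasurableSet {ξ | genSize ξ r = 0} from
      measurableSet_genSize r {0})]
  congr with ξ
  by_cases h : genSize ξ r = 0 <;> simp [h]

theorem genSize_eq_zero_of_le {ξ : ℕ × ℕ → ℕ} {r r' : ℕ} (h : r ≤ r') (h0 : genSize ξ r = 0) :
    genSize ξ r' = 0 := by
  induction r', h using Nat.le_induction with
  | base => exact h0
  | succ n _ ih => simp [genSize, ih]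

/-! ### Extinction and barriers, given a fixed point of the generating function -/

section FixedPoint

variable {lam q : ℝ}

theorem measureReal_not_survives (hlam : 0 ≤ lam)
    (hq : Tendsto (fun r => (poissonPGF lam)^[r] 0) atTop (𝓝 q)) :
    (poissonGW lam).real {ξ | ¬ Survives ξ} = q := by
  have hU : {ξ | ¬ Survives ξ} = ⋃ r, {ξ | genSize ξ r = 0} := by
    ext ξ; simp [Survives]
  have hm : Monotone fun r => {ξ : ℕ × ℕ → ℕ | genSize ξ r = 0} :=
    fun _ _ h _ h0 => genSize_eq_zero_of_le h h0
  have h1 := tendsto_measure_iUnion_atTop (μ := poissonGW lam) hm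
  rw [← hU] at h1
  have h2 := (ENNReal.tendsto_toReal (measure_ne_top _ _)).comp h1
  refine tendsto_nhds_unique h2 (hq.congr fun r => ?_)
  rw [← measureReal_genSize_eq_zero hlam r]
  rfl

theorem measureReal_not_survives_inter_pos (hlam : 0 ≤ lam)
    (hq : Tendsto (fun r => (poissonPGF lam)^[r] 0) atTop (𝓝 q)) (r : ℕ) :
    (poissonGW lam).real {ξ | ¬ Survives ξ ∧ 0 < genSize ξ r} =
      q - (poissonPGF lam)^[r] 0 := by
  rw [← measureReal_not_survives hlam hq, ← measureReal_genSize_eq_zero hlam r,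
    ← measureReal_sdiff _ (show MeasurableSet {ξ | genSize ξ r = 0} from
      measurableSet_genSize r {0})]
  · congr 1
    ext ξ
    simp [Nat.pos_iff_ne_zero]
  · intro ξ h hs
    exact (hs r).ne' h

/-- A process whose positive sizes stay below a barrier forever is negligible. -/
theorem measureReal_forall_pos_lt_eq_zero (hlam : 0 ≤ lam) (hq0 : 0 < q) (hq1 : q ≤ 1)
    (hfix : poissonPGF lam q = q)
    (hq : Tendsto (fun r => (poissonPGF lam)^[r] 0) atTop (𝓝 q)) (M : ℝ) :
    (poissonGW lam).real {ξ | ∀ r, 0 < genSize ξ r ∧ (genSize ξ r : ℝ) < M} = 0 := by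
  obtain ⟨K, hK⟩ := exists_nat_ge M
  have key : ∀ r, q ^ K * (poissonGW lam).real
      {ξ | ∀ r, 0 < genSize ξ r ∧ (genSize ξ r : ℝ) < M} ≤ q - (poissonPGF lam)^[r] 0 := by
    intro r
    have hS : MeasurableSet {ξ | 0 < genSize ξ r ∧ (genSize ξ r : ℝ) < M} :=
      measurableSet_genSize r {n | 0 < n ∧ (n : ℝ) < M}
    have e : q - (poissonPGF lam)^[r] 0 =
        ∫ ξ, (q ^ genSize ξ r - 0 ^ genSize ξ r) ∂(poissonGW lam) := by
      rw [integral_sub (integrable_pow_genSize lam hq0.le hq1 r)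
        (integrable_pow_genSize lam le_rfl zero_le_one r), integral_pow_genSize hlam r hq0.le hq1,
        integral_pow_genSize hlam r le_rfl zero_le_one, Function.iterate_fixed hfix]
    have hle : (poissonGW lam).real {ξ | ∀ r, 0 < genSize ξ r ∧ (genSize ξ r : ℝ) < M} ≤
        (poissonGW lam).real {ξ | 0 < genSize ξ r ∧ (genSize ξ r : ℝ) < M} :=
      measureReal_mono fun ξ h => h r
    refine (mul_le_mul_of_nonneg_left hle (by positivity)).trans ?_
    rw [e, mul_comm, ← smul_eq_mul, ← integral_indicator_const _ hS]
    refine integral_mono ((integrable_const _).indicator hS)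
      ((integrable_pow_genSize lam hq0.le hq1 r).sub
        (integrable_pow_genSize lam le_rfl zero_le_one r)) fun ξ => ?_
    by_cases h : 0 < genSize ξ r ∧ (genSize ξ r : ℝ) < M
    · rw [Set.indicator_of_mem (by exact h)]
      simp only [zero_pow h.1.ne', sub_zero]
      exact pow_le_pow_of_le_one hq0.le hq1 (by exact_mod_cast (h.2.trans_le hK).le)
    · rw [Set.indicator_of_notMem (by exact h)]
      simp only [sub_nonneg]
      exact pow_le_pow_left₀ le_rfl hq0.le _
  have hlim : Tendsto (fun r => q - (poissonPGF lam)^[r] 0) atTop (𝓝 0) := by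
    simpa using (tendsto_const_nhds (x := q)).sub hq
  have h1 := ge_of_tendsto' hlim key
  have h2 : 0 < q ^ K := by positivity
  have h3 := measureReal_nonneg (μ := poissonGW lam)
    (s := {ξ | ∀ r, 0 < genSize ξ r ∧ (genSize ξ r : ℝ) < M})
  nlinarith

theorem measurableSet_exists_le_genSize (M : ℝ) (r : ℕ) :
    MeasurableSet[generationFiltration r] {ξ | ∃ j ≤ r, M ≤ (genSize ξ j : ℝ)} := by
  have : {ξ | ∃ j ≤ r, M ≤ (genSize ξ j : ℝ)} =
      ⋃ j, ⋃ _ : j ≤ r, {ξ : ℕ × ℕ → ℕ | M ≤ (genSize ξ j : ℝ)} := by ext ξ; simp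
  rw [this]
  refine MeasurableSet.iUnion fun j => MeasurableSet.iUnion fun hj => ?_
  exact generationFiltration_mono hj _
    (measurable_genSize_generationFiltration j (MeasurableSet.of_discrete (s := {n : ℕ | M ≤ (n : ℝ)})))

theorem pow_genSize_le_rpow {q M : ℝ} (hq0 : 0 < q) (hq1 : q ≤ 1) {n : ℕ} (h : M ≤ n) :
    q ^ n ≤ q ^ M := by
  rw [← Real.rpow_natCast]
  exact Real.rpow_le_rpow_of_exponent_ge hq0 hq1 h

theorem setIntegral_pow_genSize_exists_le (hlam : 0 ≤ lam) (hq0 : 0 < q) (hq1 : q ≤ 1)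
    (hfix : poissonPGF lam q = q) (M : ℝ) (r : ℕ) :
    ∫ ξ in {ξ | ∃ j ≤ r, M ≤ (genSize ξ j : ℝ)}, q ^ genSize ξ r ∂(poissonGW lam) ≤
      q ^ M * (poissonGW lam).real {ξ | ∃ j ≤ r, M ≤ (genSize ξ j : ℝ)} := by
  set A : ℕ → Set (ℕ × ℕ → ℕ) := fun r => {ξ | ∃ j ≤ r, M ≤ (genSize ξ j : ℝ)} with hA
  have hAm : ∀ r, MeasurableSet (A r) := fun r =>
    generationFiltration_le r _ (measurableSet_exists_le_genSize M r)
  have hint : ∀ r S, IntegrableOn (fun ξ => q ^ genSize ξ r) S (poissonGW lam) := fun r S =>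
    (integrable_pow_genSize lam hq0.le hq1 r).integrableOn
  have hfresh : ∀ r, ∀ S ⊆ {ξ | M ≤ (genSize ξ r : ℝ)}, MeasurableSet S →
      ∫ ξ in S, q ^ genSize ξ r ∂(poissonGW lam) ≤ q ^ M * (poissonGW lam).real S := by
    intro r S hS hSm
    have := setIntegral_mono_on (hint r S) (integrable_const (q ^ M)).integrableOn hSm
      fun ξ hξ => pow_genSize_le_rpow hq0 hq1 (hS hξ)
    rwa [setIntegral_const, smul_eq_mul, mul_comm] at this
  induction r with
  | zero => exact hfresh 0 _ (fun ξ ⟨j, hj, h⟩ => by simpa [Nat.le_zero.1 hj] using h) (hAm 0)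
  | succ r ih =>
    have hsub : A r ⊆ A (r + 1) := fun ξ ⟨j, hj, h⟩ => ⟨j, hj.trans r.le_succ, h⟩
    have hdm := (hAm (r + 1)).diff (hAm r)
    have hd : A (r + 1) = A r ∪ A (r + 1) \ A r := (Set.union_sdiff_cancel hsub).symm
    have h1 := setIntegral_pow_genSize_succ hlam hq0.le hq1 r
      (measurableSet_exists_le_genSize M r)
    rw [hfix] at h1
    have h2 := hfresh (r + 1) (A (r + 1) \ A r) (by
      rintro ξ ⟨⟨j, hj, h⟩, hn⟩
      rcases hj.lt_or_eq with hj | rfl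
      · exact absurd ⟨j, Nat.lt_succ_iff.1 hj, h⟩ hn
      · exact h) hdm
    change ∫ ξ in A (r + 1), _ ∂_ ≤ q ^ M * (poissonGW lam).real (A (r + 1))
    rw [hd, setIntegral_union Set.disjoint_sdiff_right hdm (hint _ _) (hint _ _),
      measureReal_union Set.disjoint_sdiff_right hdm, mul_add]
    exact add_le_add (h1.trans_le ih) h2

theorem measureReal_exists_le_genSize_le (hlam : 0 ≤ lam) (hq0 : 0 < q) (hq1 : q ≤ 1)
    (hfix : poissonPGF lam q = q) (M : ℝ) (r : ℕ) :
    (1 - q ^ M) * (poissonGW lam).real {ξ | ∃ j ≤ r, M ≤ (genSize ξ j : ℝ)} ≤ 1 - q := by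
  set A : Set (ℕ × ℕ → ℕ) := {ξ | ∃ j ≤ r, M ≤ (genSize ξ j : ℝ)} with hA
  have hAm : MeasurableSet A :=
    generationFiltration_le r _ (measurableSet_exists_le_genSize M r)
  have h1 := setIntegral_pow_genSize_exists_le hlam hq0 hq1 hfix M r
  have hi := integrable_pow_genSize lam hq0.le hq1 r
  have h2 := integral_add_compl hAm hi
  rw [integral_pow_genSize hlam r hq0.le hq1, Function.iterate_fixed hfix] at h2
  have h3 := setIntegral_mono_on (s := Aᶜ) hi.integrableOn (integrable_const (1 : ℝ)).integrableOn
    hAm.compl fun ξ _ => pow_le_one₀ (n := genSize ξ r) hq0.le hq1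
  rw [setIntegral_const, smul_eq_mul, mul_one, probReal_compl_eq_one_sub hAm] at h3
  rw [← hA] at h1
  linarith

/-- After reaching the level `M`, the process is unlikely to be below the level `M'`. -/
theorem measureReal_exists_le_and_lt_le (hlam : 0 ≤ lam) (hq0 : 0 < q) (hq1 : q < 1)
    (hfix : poissonPGF lam q = q) {M : ℝ} (hM : 0 < M) (M' : ℝ) (r : ℕ) :
    (poissonGW lam).real {ξ | (∃ j ≤ r, M ≤ (genSize ξ j : ℝ)) ∧ (genSize ξ r : ℝ) < M'} ≤
      q ^ (M - M') * ((1 - q) / (1 - q ^ M)) := by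
  set A : Set (ℕ × ℕ → ℕ) := {ξ | ∃ j ≤ r, M ≤ (genSize ξ j : ℝ)} with hA
  have hAm : MeasurableSet A :=
    generationFiltration_le r _ (measurableSet_exists_le_genSize M r)
  set B : Set (ℕ × ℕ → ℕ) := A ∩ {ξ | (genSize ξ r : ℝ) < M'} with hB
  have hBm : MeasurableSet B := hAm.inter (measurableSet_genSize r {n | (n : ℝ) < M'})
  have hi := integrable_pow_genSize lam hq0.le hq1.le r
  have h1 := setIntegral_pow_genSize_exists_le hlam hq0 hq1.le hfix M r
  have h2 := setIntegral_mono_on (s := B) (integrable_const (q ^ M')).integrableOn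
    hi.integrableOn hBm fun ξ hξ => by
      rw [← Real.rpow_natCast]
      exact Real.rpow_le_rpow_of_exponent_ge hq0 hq1.le (le_of_lt hξ.2)
  rw [setIntegral_const, smul_eq_mul] at h2
  have h3 := setIntegral_mono_set (s := B) (t := A) hi.integrableOn
    (ae_of_all _ fun ξ => by positivity) (LE.le.eventuallyLE Set.inter_subset_left)
  have hqM : q ^ M < 1 := Real.rpow_lt_one hq0.le hq1 hM
  have h4 := measureReal_exists_le_genSize_le hlam hq0 hq1.le hfix M r
  rw [mul_comm, ← le_div_iff₀ (by linarith)] at h4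
  have h5 : (poissonGW lam).real B * q ^ M' ≤ q ^ M * ((1 - q) / (1 - q ^ M)) :=
    h2.trans (h3.trans (h1.trans (mul_le_mul_of_nonneg_left h4 (by positivity))))
  change (poissonGW lam).real B ≤ _
  rw [Real.rpow_sub hq0, div_mul_eq_mul_div]
  rwa [le_div_iff₀ (by positivity)]

end FixedPoint

/-! ### A Tauberian theorem -/

section Tauberian

variable {Ω : Type*} [MeasurableSpace Ω] {μ : ℕ → Measure Ω} [∀ n, IsFiniteMeasure (μ n)]
  {U : ℕ → Ω → ℝ} {b : ℕ → ℝ}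

theorem integrable_mul_comp_of_continuous (hU : ∀ n, Measurable (U n))
    (hU1 : ∀ n x, U n x ∈ Set.Icc (0 : ℝ) 1) {g : ℝ → ℝ} (hg : Continuous g) (n : ℕ) :
    Integrable (fun x => U n x * g (U n x)) (μ n) := by
  obtain ⟨C, hC⟩ := isCompact_Icc.exists_bound_of_continuousOn
    (f := fun u : ℝ => u * g u) (s := Set.Icc (0 : ℝ) 1) (by fun_prop)
  exact Integrable.of_bound
    (((continuous_id.mul hg).measurable).comp (hU n)).aestronglyMeasurable C
    (ae_of_all _ fun x => hC _ (hU1 n x))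

theorem tendsto_integral_mul_polynomial (hU : ∀ n, Measurable (U n))
    (hU1 : ∀ n x, U n x ∈ Set.Icc (0 : ℝ) 1)
    (h : ∀ k : ℕ, Tendsto (fun n => (∫ x, U n x ^ (k + 1) ∂(μ n)) / b n) atTop
      (𝓝 (1 / ((k : ℝ) + 1)))) (p : Polynomial ℝ) :
    Tendsto (fun n => (∫ x, U n x * p.eval (U n x) ∂(μ n)) / b n) atTop
      (𝓝 (∫ u in (0 : ℝ)..1, p.eval u)) := by
  induction p using Polynomial.induction_on' with
  | add p q hp hq =>
    have e : ∫ u in (0 : ℝ)..1, (p + q).eval u =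
        (∫ u in (0 : ℝ)..1, p.eval u) + ∫ u in (0 : ℝ)..1, q.eval u := by
      simp_rw [Polynomial.eval_add]
      exact intervalIntegral.integral_add (p.continuous.intervalIntegrable _ _)
        (q.continuous.intervalIntegrable _ _)
    rw [e]
    refine (hp.add hq).congr fun n => ?_
    rw [← add_div, ← integral_add (integrable_mul_comp_of_continuous hU hU1 p.continuous n)
      (integrable_mul_comp_of_continuous hU hU1 q.continuous n)]
    simp_rw [Polynomial.eval_add, mul_add]
  | monomial k a =>
    have e : ∫ u in (0 : ℝ)..1, (Polynomial.monomial k a).eval u = a * (1 / ((k : ℝ) + 1)) := by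
      simp [Polynomial.eval_monomial, integral_pow]
    rw [e]
    refine ((h k).const_mul a).congr fun n => ?_
    rw [← mul_div_assoc, ← integral_const_mul]
    congr 2 with x
    rw [Polynomial.eval_monomial]
    ring

theorem tendsto_integral_mul_continuous (hU : ∀ n, Measurable (U n))
    (hU1 : ∀ n x, U n x ∈ Set.Icc (0 : ℝ) 1) (hb : ∀ᶠ n in atTop, 0 < b n)
    (h : ∀ k : ℕ, Tendsto (fun n => (∫ x, U n x ^ (k + 1) ∂(μ n)) / b n) atTop
      (𝓝 (1 / ((k : ℝ) + 1)))) {g : ℝ → ℝ} (hg : Continuous g) :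
    Tendsto (fun n => (∫ x, U n x * g (U n x) ∂(μ n)) / b n) atTop
      (𝓝 (∫ u in (0 : ℝ)..1, g u)) := by
  rw [Metric.tendsto_atTop']
  intro δ hδ
  obtain ⟨p, hp⟩ := exists_polynomial_near_of_continuousOn 0 1 g hg.continuousOn (δ / 4)
    (by positivity)
  have h1 := tendsto_integral_mul_polynomial hU hU1 h p
  have h0 := h 0
  simp only [zero_add, pow_one, CharP.cast_eq_zero, div_one] at h0
  have e1 := Metric.tendsto_nhds.1 h1 (δ / 4) (by positivity)
  have e2 := h0.eventually (gt_mem_nhds (show (1 : ℝ) < 2 by norm_num))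
  obtain ⟨N, hN⟩ := eventually_atTop.1 (e1.and (e2.and hb))
  refine ⟨N, fun n hn => ?_⟩
  obtain ⟨a1, a2, a3⟩ := hN n hn.le
  have i1 := integrable_mul_comp_of_continuous (μ := μ) hU hU1 hg n
  have i2 := integrable_mul_comp_of_continuous (μ := μ) hU hU1 p.continuous n
  have i3 : Integrable (fun x => U n x) (μ n) := by
    simpa using integrable_mul_comp_of_continuous (μ := μ) hU hU1
      (continuous_const (y := (1 : ℝ))) n
  have d1 : |(∫ x, U n x * g (U n x) ∂(μ n)) / b n -
      (∫ x, U n x * p.eval (U n x) ∂(μ n)) / b n| ≤ δ / 4 * 2 := by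
    rw [← sub_div, abs_div, abs_of_pos a3, ← integral_sub i1 i2]
    have : ‖∫ x, (U n x * g (U n x) - U n x * p.eval (U n x)) ∂(μ n)‖ ≤
        ∫ x, δ / 4 * U n x ∂(μ n) := by
      refine norm_integral_le_of_norm_le (i3.const_mul _) (ae_of_all _ fun x => ?_)
      rw [← mul_sub, norm_mul, Real.norm_of_nonneg (hU1 n x).1, mul_comm, norm_sub_rev]
      exact mul_le_mul_of_nonneg_right (hp _ (hU1 n x)).le (hU1 n x).1
    rw [integral_const_mul, Real.norm_eq_abs] at this
    calc _ ≤ δ / 4 * (∫ x, U n x ∂(μ n)) / b n := by gcongr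
      _ = δ / 4 * ((∫ x, U n x ∂(μ n)) / b n) := by ring
      _ ≤ _ := by gcongr
  have d2 : |(∫ u in (0 : ℝ)..1, p.eval u) - ∫ u in (0 : ℝ)..1, g u| ≤ δ / 4 := by
    rw [← intervalIntegral.integral_sub (p.continuous.intervalIntegrable _ _)
      (hg.intervalIntegrable _ _)]
    have := intervalIntegral.norm_integral_le_of_norm_le_const (a := (0 : ℝ)) (b := 1)
      (f := fun u => p.eval u - g u) (C := δ / 4) fun u hu => by
        rw [Set.uIoc_of_le zero_le_one] at hu
        exact (hp u ⟨hu.1.le, hu.2⟩).le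
    simpa using this
  rw [Real.dist_eq] at a1 ⊢
  rw [abs_lt] at *
  rw [abs_le] at d1 d2
  constructor <;> linarith [d1.1, d1.2, d2.1, d2.2, a1.1, a1.2]

/-- A continuous function on the line that lies between `u⁻¹ 1_{u ≥ a₂}` and `u⁻¹ 1_{u > a₁}`. -/
theorem exists_continuous_between_inv {a₁ a₂ : ℝ} (h0 : 0 < a₁) (h : a₁ < a₂) :
    ∃ g : ℝ → ℝ, Continuous g ∧ (∀ u, 0 ≤ g u) ∧ (∀ u, a₁ ≤ u → g u ≤ u⁻¹) ∧
      (∀ u, u ≤ a₁ → g u = 0) ∧ ∀ u, a₂ ≤ u → g u = u⁻¹ := by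
  refine ⟨fun u => max 0 (min 1 ((u - a₁) / (a₂ - a₁))) * (max u a₁)⁻¹, ?_, ?_, ?_, ?_, ?_⟩
  · exact (by fun_prop : Continuous fun u => max 0 (min 1 ((u - a₁) / (a₂ - a₁)))).mul
      ((by fun_prop : Continuous fun u => max u a₁).inv₀ fun u =>
        (h0.trans_le (le_max_right u a₁)).ne')
  · intro u
    exact mul_nonneg (le_max_left _ _) (inv_nonneg.2 (h0.le.trans (le_max_right u a₁)))
  · intro u hu
    simp only [max_eq_left hu]
    exact mul_le_of_le_one_left (inv_nonneg.2 (h0.le.trans hu))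
      (max_le zero_le_one (min_le_left _ _))
  · intro u hu
    have : (u - a₁) / (a₂ - a₁) ≤ 0 :=
      div_nonpos_of_nonpos_of_nonneg (by linarith) (by linarith)
    simp [max_eq_left ((min_le_right _ _).trans this)]
  · intro u hu
    have : 1 ≤ (u - a₁) / (a₂ - a₁) := by rw [le_div_iff₀ (by linarith)]; linarith
    simp [min_eq_left this, max_eq_left (h.le.trans hu)]

theorem intervalIntegral_inv_one {a : ℝ} (h : 0 < a) : ∫ u in a..1, u⁻¹ = -Real.log a := by
  rw [integral_inv_of_pos h one_pos, one_div, Real.log_inv]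

/-- If all positive integer moments of `U` are asymptotically those of `u⁻¹ du` on `(0, 1)`, then so
are the measures of the events `a < U`. -/
theorem tendsto_measureReal_lt_of_tendsto_moments (hU : ∀ n, Measurable (U n))
    (hU1 : ∀ n x, U n x ∈ Set.Icc (0 : ℝ) 1) (hb : ∀ᶠ n in atTop, 0 < b n)
    (h : ∀ k : ℕ, Tendsto (fun n => (∫ x, U n x ^ (k + 1) ∂(μ n)) / b n) atTop
      (𝓝 (1 / ((k : ℝ) + 1)))) {a : ℝ} (ha0 : 0 < a) (ha1 : a < 1) :
    Tendsto (fun n => (μ n).real {x | a < U n x} / b n) atTop (𝓝 (-Real.log a)) := by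
  have hlog : ContinuousAt (fun x => -Real.log x) a := (Real.continuousAt_log ha0.ne').neg
  have hm : ∀ n, MeasurableSet {x | a < U n x} := fun n => measurableSet_lt measurable_const (hU n)
  rw [tendsto_order]
  constructor
  · intro y hy
    have hev := (hlog.eventually (lt_mem_nhds hy)).filter_mono (nhdsWithin_le_nhds (s := Set.Ioi a))
    obtain ⟨a₂, hy2, ha2, ha21⟩ := (hev.and (Ioo_mem_nhdsGT ha1)).exists
    obtain ⟨g, hg, g0, g1, gz, ginv⟩ := exists_continuous_between_inv ha0 ha2
    have ht := tendsto_integral_mul_continuous hU hU1 hb h hg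
    have hI : y < ∫ u in (0 : ℝ)..1, g u := by
      refine hy2.trans_le ?_
      rw [← intervalIntegral_inv_one (ha0.trans ha2),
        ← intervalIntegral.integral_add_adjacent_intervals (b := a₂)
          (hg.intervalIntegrable 0 a₂) (hg.intervalIntegrable a₂ 1)]
      have e : ∫ u in a₂..1, g u = ∫ u in a₂..1, u⁻¹ :=
        intervalIntegral.integral_congr fun u hu => by
          rw [Set.uIcc_of_le ha21.le] at hu
          exact ginv u hu.1
      have := intervalIntegral.integral_nonneg (μ := volume) (a := 0) (b := a₂) (f := g)
        (ha0.trans ha2).le fun u _ => g0 u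
      linarith
    filter_upwards [ht.eventually (lt_mem_nhds hI), hb] with n hn hbn
    refine hn.trans_le (div_le_div_of_nonneg_right ?_ hbn.le)
    rw [← integral_indicator_one (hm n)]
    refine integral_mono (integrable_mul_comp_of_continuous hU hU1 hg n)
      ((integrable_const 1).indicator (hm n)) fun x => ?_
    by_cases hx : a < U n x
    · rw [Set.indicator_of_mem (by exact hx)]
      have hpos := ha0.trans hx
      calc U n x * g (U n x) ≤ U n x * (U n x)⁻¹ := by gcongr; exact g1 _ hx.le
        _ = 1 := mul_inv_cancel₀ hpos.ne'
    · rw [Set.indicator_of_notMem (by exact hx)]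
      simp [gz _ (not_lt.1 hx)]
  · intro y hy
    have hev := (hlog.eventually (gt_mem_nhds hy)).filter_mono (nhdsWithin_le_nhds (s := Set.Iio a))
    obtain ⟨a₁, hy1, ha1', ha1a⟩ := (hev.and (Ioo_mem_nhdsLT ha0)).exists
    obtain ⟨g, hg, g0, g1, gz, ginv⟩ := exists_continuous_between_inv ha1' ha1a
    have ht := tendsto_integral_mul_continuous hU hU1 hb h hg
    have hI : ∫ u in (0 : ℝ)..1, g u < y := by
      refine lt_of_le_of_lt ?_ hy1
      rw [← intervalIntegral_inv_one ha1',
        ← intervalIntegral.integral_add_adjacent_intervals (b := a₁)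
          (hg.intervalIntegrable 0 a₁) (hg.intervalIntegrable a₁ 1)]
      have e : ∫ u in (0 : ℝ)..a₁, g u = ∫ u in (0 : ℝ)..a₁, (0 : ℝ) :=
        intervalIntegral.integral_congr fun u hu => by
          rw [Set.uIcc_of_le ha1'.le] at hu
          exact gz u hu.2
      have hle : a₁ ≤ 1 := (ha1a.trans ha1).le
      have := intervalIntegral.integral_mono_on (μ := volume) (a := a₁) (b := 1) (f := g)
        (g := fun u => u⁻¹) hle (hg.intervalIntegrable _ _)
        (intervalIntegral.intervalIntegrable_inv
          (fun u hu => by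
            rw [Set.uIcc_of_le hle] at hu
            exact (ha1'.trans_le hu.1).ne') continuousOn_id) fun u hu => g1 u hu.1
      rw [e, intervalIntegral.integral_zero, zero_add]
      exact this
    filter_upwards [ht.eventually (gt_mem_nhds hI), hb] with n hn hbn
    refine lt_of_le_of_lt (div_le_div_of_nonneg_right ?_ hbn.le) hn
    rw [← integral_indicator_one (hm n)]
    refine integral_mono ((integrable_const 1).indicator (hm n))
      (integrable_mul_comp_of_continuous hU hU1 hg n) fun x => ?_
    by_cases hx : a < U n x
    · rw [Set.indicator_of_mem (by exact hx)]
      simp only [Pi.one_apply]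
      rw [ginv _ hx.le, mul_inv_cancel₀ (ha0.trans hx).ne']
    · rw [Set.indicator_of_notMem (by exact hx)]
      exact mul_nonneg (hU1 n x).1 (g0 _)

end Tauberian

/-! ### Iterates of the generating function near its fixed points -/

theorem one_div_add_half_le {z : ℝ} (hz : 0 < z) : 1 / z + 1 / 2 ≤ 1 / (1 - Real.exp (-z)) := by
  have h1 : Real.exp (-z) < 1 := Real.exp_lt_one_iff.2 (by linarith)
  have hz1 : 1 < Real.exp z := Real.one_lt_exp_iff.2 hz
  have h := Real.le_log_one_add_of_nonneg (x := Real.exp z - 1) (by linarith)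
  rw [add_sub_cancel, Real.log_exp, div_le_iff₀ (by linarith)] at h
  rw [div_add_div _ _ hz.ne' two_ne_zero, div_le_div_iff₀ (by positivity) (by linarith)]
  have e : Real.exp (-z) * Real.exp z = 1 := by rw [← Real.exp_add]; simp
  nlinarith [Real.exp_pos (-z)]

theorem one_div_le_add_half_add {z : ℝ} (hz : 0 < z) (hz1 : z ≤ 1) :
    1 / (1 - Real.exp (-z)) ≤ 1 / z + 1 / 2 + z := by
  have h := Real.quadratic_le_exp_of_nonneg hz.le
  have e : Real.exp (-z) * Real.exp z = 1 := by rw [← Real.exp_add]; simp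
  have h2 : Real.exp (-z) ≤ 1 - z + z ^ 2 / 2 := by
    have h3 : Real.exp (-z) * (1 + z + z ^ 2 / 2) ≤ 1 :=
      (mul_le_mul_of_nonneg_left h (Real.exp_pos _).le).trans e.le
    have h4 : 1 ≤ (1 - z + z ^ 2 / 2) * (1 + z + z ^ 2 / 2) := by nlinarith [pow_pos hz 4]
    exact le_of_mul_le_mul_right (h3.trans h4) (by positivity)
  have h5 : z - z ^ 2 / 2 ≤ 1 - Real.exp (-z) := by linarith
  have h6 : 0 < z - z ^ 2 / 2 := by nlinarith
  refine (one_div_le_one_div_of_le h6 h5).trans ?_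
  rw [div_le_iff₀ h6]
  have : (1 / z + 1 / 2 + z) * (z - z ^ 2 / 2) = 1 + z ^ 2 * (3 / 4 - z / 2) := by
    field_simp; ring
  rw [this]
  nlinarith [mul_nonneg (sq_nonneg z) (show 0 ≤ 3 / 4 - z / 2 by linarith)]

theorem one_div_exp_sub_one {z : ℝ} (hz : 0 < z) :
    1 / (Real.exp z - 1) = 1 / (1 - Real.exp (-z)) - 1 := by
  have hz1 : 1 < Real.exp z := Real.one_lt_exp_iff.2 hz
  have h0 : Real.exp z - 1 ≠ 0 := by linarith
  rw [Real.exp_neg, div_sub_one (by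
    rw [sub_ne_zero]; exact (inv_lt_one_of_one_lt₀ hz1).ne'), div_eq_div_iff h0 (by
    rw [sub_ne_zero]; exact (inv_lt_one_of_one_lt₀ hz1).ne')]
  field_simp
  ring

/-- The sum `d + d ^ 2 + ⋯ + d ^ k`. -/
def geomTail (d : ℝ) (k : ℕ) : ℝ := d * (1 - d ^ k) / (1 - d)

theorem geomTail_succ {d : ℝ} (h1 : d ≠ 1) (k : ℕ) :
    geomTail d (k + 1) = geomTail d k + d ^ (k + 1) := by
  have : 1 - d ≠ 0 := sub_ne_zero.2 h1.symm
  unfold geomTail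
  field_simp
  ring

theorem le_pow_mul_of_div_add_le {d e : ℝ} (h0 : 0 < d) (h1 : d ≠ 1) {z : ℕ → ℝ}
    (h : ∀ k, z k / d + e ≤ z (k + 1)) (k : ℕ) : z 0 + e * geomTail d k ≤ d ^ k * z k := by
  induction k with
  | zero => simp [geomTail]
  | succ k ih =>
    rw [geomTail_succ h1]
    have := mul_le_mul_of_nonneg_left (h k) (pow_pos h0 (k + 1)).le
    have e2 : d ^ (k + 1) * (z k / d + e) = d ^ k * z k + e * d ^ (k + 1) := by
      field_simp
      ring
    linarith

theorem pow_mul_le_of_le_div_add {d e : ℝ} (h0 : 0 < d) (h1 : d ≠ 1) {z : ℕ → ℝ}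
    (h : ∀ k, z (k + 1) ≤ z k / d + e) (k : ℕ) : d ^ k * z k ≤ z 0 + e * geomTail d k := by
  have := le_pow_mul_of_div_add_le (e := -e) (z := fun k => -z k) h0 h1
    (fun k => by have := h k; rw [neg_div]; linarith) k
  linarith

/-- The extinction probability of the process with parameter `lam > 1`. -/
def extinctionProb (lam : ℝ) : ℝ := dualParam lam / lam

section Supercritical

variable {lam : ℝ}

theorem dualParam_pos (h : 1 < lam) : 0 < dualParam lam := by
  have h1 := (isDual_dualParam h).2
  have h2 : 0 < lam * Real.exp (-lam) := by positivity
  rw [← h1] at h2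
  exact pos_of_mul_pos_left h2 (Real.exp_pos _).le

theorem dualParam_lt_one (h : 1 < lam) : dualParam lam < 1 := (isDual_dualParam h).1

theorem mul_extinctionProb (h : 1 < lam) : lam * extinctionProb lam = dualParam lam := by
  unfold extinctionProb
  field_simp

theorem extinctionProb_pos (h : 1 < lam) : 0 < extinctionProb lam :=
  div_pos (dualParam_pos h) (by linarith)

theorem extinctionProb_lt_one (h : 1 < lam) : extinctionProb lam < 1 := by
  rw [extinctionProb, div_lt_one (by linarith)]
  linarith [dualParam_lt_one h]

theorem poissonPGF_extinctionProb (h : 1 < lam) :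
    poissonPGF lam (extinctionProb lam) = extinctionProb lam := by
  have h1 := (isDual_dualParam h).2
  rw [poissonPGF, mul_sub, mul_extinctionProb h, mul_one, extinctionProb,
    eq_div_iff (by linarith), sub_eq_add_neg, Real.exp_add]
  calc _ = Real.exp (dualParam lam) * (lam * Real.exp (-lam)) := by ring
    _ = dualParam lam * (Real.exp (dualParam lam) * Real.exp (-dualParam lam)) := by
      rw [← h1]; ring
    _ = _ := by rw [← Real.exp_add]; simp

theorem strictMono_poissonPGF (h : 0 < lam) : StrictMono (poissonPGF lam) := fun a b hab =>
  Real.exp_lt_exp.2 (mul_lt_mul_of_pos_left (by linarith) h)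

theorem poissonPGF_one : poissonPGF lam 1 = 1 := by simp [poissonPGF]

theorem iterate_poissonPGF_lt_one (h : 1 < lam) {s : ℝ} (hs : s < 1) (k : ℕ) :
    (poissonPGF lam)^[k] s < 1 := by
  have := (strictMono_poissonPGF (by linarith : 0 < lam)).iterate k hs
  rwa [Function.iterate_fixed poissonPGF_one] at this

theorem extinctionProb_lt_iterate (h : 1 < lam) {s : ℝ} (hs : extinctionProb lam < s) (k : ℕ) :
    extinctionProb lam < (poissonPGF lam)^[k] s := by
  have := (strictMono_poissonPGF (by linarith : 0 < lam)).iterate k hs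
  rwa [Function.iterate_fixed (poissonPGF_extinctionProb h)] at this

theorem iterate_lt_extinctionProb (h : 1 < lam) {s : ℝ} (hs : s < extinctionProb lam) (k : ℕ) :
    (poissonPGF lam)^[k] s < extinctionProb lam := by
  have := (strictMono_poissonPGF (by linarith : 0 < lam)).iterate k hs
  rwa [Function.iterate_fixed (poissonPGF_extinctionProb h)] at this

theorem one_sub_extinctionProb_eq (h : 1 < lam) :
    1 - Real.exp (-(lam * (1 - extinctionProb lam))) = 1 - extinctionProb lam := by
  nth_rw 2 [← poissonPGF_extinctionProb h]
  rw [poissonPGF]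
  ring_nf

theorem mul_one_sub_extinctionProb_le (h : 1 < lam) :
    lam * (1 - extinctionProb lam) ≤ 2 * (lam - 1) := by
  have hp : 0 < 1 - extinctionProb lam := by linarith [extinctionProb_lt_one h]
  have h1 := one_div_add_half_le (z := lam * (1 - extinctionProb lam)) (by positivity)
  rw [one_sub_extinctionProb_eq h, div_add_div _ _ (by positivity) two_ne_zero,
    div_le_div_iff₀ (by positivity) hp] at h1
  have h2 := le_of_mul_le_mul_right (a := 1 - extinctionProb lam)
    (b := 1 * 2 + lam * (1 - extinctionProb lam) * 1) (c := lam * 2) (by linarith) hp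
  linarith

theorem sub_one_le_mul_one_sub_extinctionProb (h : 1 < lam) (h2 : 2 * (lam - 1) ≤ 1) :
    lam - 1 ≤ lam * (1 - extinctionProb lam) * (1 / 2 + 2 * (lam - 1)) := by
  have hp : 0 < 1 - extinctionProb lam := by linarith [extinctionProb_lt_one h]
  have hle := mul_one_sub_extinctionProb_le h
  have h1 := one_div_le_add_half_add (z := lam * (1 - extinctionProb lam)) (by positivity)
    (by linarith)
  rw [one_sub_extinctionProb_eq h] at h1
  have h3 := mul_le_mul_of_nonneg_left h1
    (show 0 ≤ lam * (1 - extinctionProb lam) by positivity)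
  have e1 : lam * (1 - extinctionProb lam) * (1 / (1 - extinctionProb lam)) = lam := by
    field_simp
  have e2 : lam * (1 - extinctionProb lam) * (1 / (lam * (1 - extinctionProb lam))) = 1 := by
    field_simp
  rw [e1, mul_add, mul_add, e2] at h3
  nlinarith [mul_le_mul_of_nonneg_left hle
    (show 0 ≤ lam * (1 - extinctionProb lam) by positivity)]

theorem iterate_growth_bounds (h : 1 < lam) (h2 : 2 * (lam - 1) ≤ 1) {s : ℝ}
    (hs : extinctionProb lam < s) (hs1 : s < 1) (m : ℕ) :
    1 / (1 - s) + 1 / 2 * geomTail lam m ≤ lam ^ m * (1 / (1 - (poissonPGF lam)^[m] s)) ∧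
      lam ^ m * (1 / (1 - (poissonPGF lam)^[m] s)) ≤
        1 / (1 - s) + (1 / 2 + 2 * (lam - 1)) * geomTail lam m := by
  have hlam : 0 < lam := by linarith
  set z : ℕ → ℝ := fun k => 1 / (1 - (poissonPGF lam)^[k] s) with hz
  have hstep : ∀ k, z (k + 1) =
      1 / (1 - Real.exp (-(lam * (1 - (poissonPGF lam)^[k] s)))) := fun k => by
    simp only [hz, Function.iterate_succ_apply', poissonPGF]
    ring_nf
  have hpos : ∀ k, 0 < 1 - (poissonPGF lam)^[k] s := fun k => by
    linarith [iterate_poissonPGF_lt_one h hs1 k]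
  have hle : ∀ k, lam * (1 - (poissonPGF lam)^[k] s) ≤ 2 * (lam - 1) := fun k =>
    (mul_le_mul_of_nonneg_left (by linarith [extinctionProb_lt_iterate h hs k]) hlam.le).trans
      (mul_one_sub_extinctionProb_le h)
  have e : ∀ k, 1 / (lam * (1 - (poissonPGF lam)^[k] s)) = z k / lam := fun k => by
    simp only [hz]; rw [div_div, mul_comm]
  constructor
  · refine le_pow_mul_of_div_add_le (z := z) hlam h.ne' (fun k => ?_) m
    rw [hstep, ← e]
    exact one_div_add_half_le (mul_pos hlam (hpos k))
  · refine pow_mul_le_of_le_div_add (z := z) hlam h.ne' (fun k => ?_) m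
    rw [hstep, ← e]
    have := one_div_le_add_half_add (mul_pos hlam (hpos k)) ((hle k).trans h2)
    linarith [hle k]

theorem poissonPGF_eq_mul_exp (h : 1 < lam) (s : ℝ) :
    poissonPGF lam s = extinctionProb lam * Real.exp (lam * (s - extinctionProb lam)) := by
  nth_rw 1 [← poissonPGF_extinctionProb h]
  rw [poissonPGF, poissonPGF, ← Real.exp_add]
  ring_nf

theorem iterate_decay_bounds (h : 1 < lam) (h2 : 2 * (lam - 1) ≤ 1) {s : ℝ}
    (hs : extinctionProb lam < s) (hs1 : s < 1) (k : ℕ) :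
    1 / (s - extinctionProb lam) - 1 / (2 * extinctionProb lam) * geomTail (dualParam lam) k ≤
        dualParam lam ^ k * (1 / ((poissonPGF lam)^[k] s - extinctionProb lam)) ∧
      dualParam lam ^ k * (1 / ((poissonPGF lam)^[k] s - extinctionProb lam)) ≤
        1 / (s - extinctionProb lam) -
          (1 / 2 - 2 * (lam - 1)) / extinctionProb lam * geomTail (dualParam lam) k := by
  have hlam : 0 < lam := by linarith
  have hd0 := dualParam_pos h
  have hd1 := dualParam_lt_one h
  set q := extinctionProb lam with hq
  have hq0 : 0 < q := extinctionProb_pos h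
  set z : ℕ → ℝ := fun k => 1 / ((poissonPGF lam)^[k] s - q) with hz
  set w : ℕ → ℝ := fun k => (poissonPGF lam)^[k] s - q with hw
  have hpos : ∀ k, 0 < w k := fun k => by
    simp only [hw]; linarith [extinctionProb_lt_iterate h hs k]
  have hle : ∀ k, lam * w k ≤ 2 * (lam - 1) := fun k =>
    (mul_le_mul_of_nonneg_left (by
      simp only [hw]; linarith [iterate_poissonPGF_lt_one h hs1 k]) hlam.le).trans
      (mul_one_sub_extinctionProb_le h)
  have hstep : ∀ k, z (k + 1) = (1 / (1 - Real.exp (-(lam * w k))) - 1) / q := fun k => by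
    rw [← one_div_exp_sub_one (mul_pos hlam (hpos k)), div_div, mul_comm _ q]
    simp only [hz, hw, Function.iterate_succ_apply']
    rw [poissonPGF_eq_mul_exp h, mul_sub_one]
  have e : ∀ k, 1 / (lam * w k) / q = z k / dualParam lam := fun k => by
    rw [← mul_extinctionProb h, ← hq]
    simp only [hz, hw]
    rw [div_div, div_div]
    ring_nf
  constructor
  · have := le_pow_mul_of_div_add_le (z := z) (e := -(1 / (2 * q))) hd0 hd1.ne (fun k => ?_) k
    · simp only [hz, Function.iterate_zero, id] at this ⊢
      linarith
    · have h3 := one_div_add_half_le (mul_pos hlam (hpos k))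
      rw [hstep, ← e]
      calc _ = (1 / (lam * w k) + 1 / 2 - 1) / q := by field_simp; ring
        _ ≤ _ := by gcongr
  · have := pow_mul_le_of_le_div_add (z := z) (e := -((1 / 2 - 2 * (lam - 1)) / q)) hd0 hd1.ne
      (fun k => ?_) k
    · simp only [hz, Function.iterate_zero, id] at this ⊢
      linarith
    · have h3 := one_div_le_add_half_add (mul_pos hlam (hpos k)) ((hle k).trans h2)
      rw [hstep, ← e, ← sub_eq_add_neg, ← sub_div]
      refine div_le_div_of_nonneg_right ?_ hq0.le
      linarith [hle k]

theorem le_dualParam_pow_mul_extinction (h : 1 < lam) (k : ℕ) :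
    1 / (2 * extinctionProb lam) * geomTail (dualParam lam) k ≤
      dualParam lam ^ k * (1 / (extinctionProb lam - (poissonPGF lam)^[k] 0)) := by
  have hlam : 0 < lam := by linarith
  have hd0 := dualParam_pos h
  have hd1 := dualParam_lt_one h
  set q := extinctionProb lam with hq
  have hq0 : 0 < q := extinctionProb_pos h
  set z : ℕ → ℝ := fun k => 1 / (q - (poissonPGF lam)^[k] 0) with hz
  set w : ℕ → ℝ := fun k => q - (poissonPGF lam)^[k] 0 with hw
  have hpos : ∀ k, 0 < w k := fun k => by
    simp only [hw]; linarith [iterate_lt_extinctionProb h (s := 0) hq0 k]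
  have hstep : ∀ k, z (k + 1) = (1 / (1 - Real.exp (-(lam * w k)))) / q := fun k => by
    rw [div_div, mul_comm _ q]
    simp only [hz, hw, Function.iterate_succ_apply']
    rw [poissonPGF_eq_mul_exp h, ← hq, mul_one_sub, ← mul_neg, neg_sub]
  have e : ∀ k, 1 / (lam * w k) / q = z k / dualParam lam := fun k => by
    rw [← mul_extinctionProb h, ← hq]
    simp only [hz, hw]
    rw [div_div, div_div]
    ring_nf
  have h0 : 0 ≤ z 0 := (one_div_pos.2 (hpos 0)).le
  have := le_pow_mul_of_div_add_le (z := z) (e := 1 / (2 * q)) hd0 hd1.ne (fun k => ?_) k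
  · linarith
  · have h3 := one_div_add_half_le (mul_pos hlam (hpos k))
    rw [hstep, ← e]
    calc _ = (1 / (lam * w k) + 1 / 2) / q := by field_simp
      _ ≤ _ := by gcongr

theorem extinctionProb_sub_iterate_le (h : 1 < lam) (k : ℕ) (hk : k ≠ 0) :
    extinctionProb lam - (poissonPGF lam)^[k] 0 ≤
      dualParam lam ^ k * (2 * extinctionProb lam * (1 - dualParam lam) /
        (dualParam lam * (1 - dualParam lam ^ k))) := by
  have hd0 := dualParam_pos h
  have hd1 := dualParam_lt_one h
  have hq0 := extinctionProb_pos h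
  have hk1 : 0 < 1 - dualParam lam ^ k := by linarith [pow_lt_one₀ hd0.le hd1 hk]
  have h1 := le_dualParam_pow_mul_extinction h k
  have hpos : 0 < extinctionProb lam - (poissonPGF lam)^[k] 0 := by
    linarith [iterate_lt_extinctionProb h (s := 0) hq0 k]
  have h2 : 0 < 1 - dualParam lam := by linarith
  have hg : 0 < 1 / (2 * extinctionProb lam) * geomTail (dualParam lam) k := by
    unfold geomTail; positivity
  rw [mul_one_div, le_div_iff₀ hpos, mul_comm, ← le_div_iff₀ hg] at h1
  refine h1.trans_eq ?_
  unfold geomTail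
  field_simp

theorem tendsto_iterate_poissonPGF_zero (h : 1 < lam) :
    Tendsto (fun r => (poissonPGF lam)^[r] 0) atTop (𝓝 (extinctionProb lam)) := by
  have hd0 := dualParam_pos h
  have hd1 := dualParam_lt_one h
  have hpow := tendsto_pow_atTop_nhds_zero_of_lt_one hd0.le hd1
  have hlim : Tendsto (fun k : ℕ => dualParam lam ^ k *
      (2 * extinctionProb lam * (1 - dualParam lam) / (dualParam lam * (1 - dualParam lam ^ k))))
      atTop (𝓝 (0 * (2 * extinctionProb lam * (1 - dualParam lam) /
        (dualParam lam * (1 - 0))))) :=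
    hpow.mul (tendsto_const_nhds.div ((tendsto_const_nhds.sub hpow).const_mul _)
      (by simpa using hd0.ne'))
  rw [zero_mul] at hlim
  have h0 : Tendsto (fun k => extinctionProb lam - (poissonPGF lam)^[k] 0) atTop (𝓝 0) := by
    refine tendsto_of_tendsto_of_tendsto_of_le_of_le' tendsto_const_nhds hlim
      (Eventually.of_forall fun k => ?_) ?_
    · linarith [iterate_lt_extinctionProb h (s := 0) (extinctionProb_pos h) k]
    · filter_upwards [eventually_ne_atTop 0] with k hk
      exact extinctionProb_sub_iterate_le h k hk
  simpa using (tendsto_const_nhds (x := extinctionProb lam)).sub h0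

end Supercritical

/-! ### Asymptotics in the slightly supercritical regime -/

theorem tendsto_rpow_one_of_bounded {a x : ℕ → ℝ} (ha : Tendsto a atTop (𝓝 1)) {C : ℝ}
    (hx : ∀ᶠ n in atTop, |x n| ≤ C) : Tendsto (fun n => a n ^ x n) atTop (𝓝 1) := by
  have hlog : Tendsto (fun n => Real.log (a n)) atTop (𝓝 0) := by
    simpa using ha.log one_ne_zero
  have h0 : Tendsto (fun n => Real.log (a n) * x n) atTop (𝓝 0) := by
    refine squeeze_zero_norm' (a := fun n => |Real.log (a n)| * C) ?_ (by
      simpa using hlog.abs.mul_const C)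
    filter_upwards [hx] with n hn
    rw [norm_mul, Real.norm_eq_abs, Real.norm_eq_abs]
    gcongr
  have h1 := (Real.continuous_exp.tendsto 0).comp h0
  rw [Real.exp_zero] at h1
  refine h1.congr' ?_
  filter_upwards [ha.eventually (lt_mem_nhds one_pos)] with n hn
  rw [Function.comp_apply, Real.rpow_def_of_pos hn]

theorem tendsto_rpow_div_rpow {a x y : ℕ → ℝ} (ha : Tendsto a atTop (𝓝 1)) {C : ℝ}
    (hx : ∀ᶠ n in atTop, |x n - y n| ≤ C) :
    Tendsto (fun n => a n ^ x n / a n ^ y n) atTop (𝓝 1) := by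
  refine (tendsto_rpow_one_of_bounded ha hx).congr' ?_
  filter_upwards [ha.eventually (lt_mem_nhds one_pos)] with n hn
  rw [Real.rpow_sub hn]

theorem tendsto_div_one_sub_exp_neg {x : ℕ → ℝ} (hx0 : ∀ᶠ n in atTop, 0 < x n)
    (hx : Tendsto x atTop (𝓝 0)) :
    Tendsto (fun n => x n / (1 - Real.exp (-x n))) atTop (𝓝 1) := by
  have l1 : Tendsto (fun n => 1 + x n / 2) atTop (𝓝 1) := by
    simpa using (hx.div_const 2).const_add 1
  have l2 : Tendsto (fun n => 1 + x n / 2 + x n ^ 2) atTop (𝓝 1) := by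
    simpa using l1.add (hx.pow 2)
  refine tendsto_of_tendsto_of_tendsto_of_le_of_le' l1 l2 ?_ ?_
  · filter_upwards [hx0] with n hn
    have := mul_le_mul_of_nonneg_left (one_div_add_half_le hn) hn.le
    have e : x n * (1 / x n + 1 / 2) = 1 + x n / 2 := by field_simp
    rw [e] at this
    rwa [mul_one_div] at this
  · filter_upwards [hx0, hx.eventually (gt_mem_nhds one_pos)] with n hn hn1
    have := mul_le_mul_of_nonneg_left (one_div_le_add_half_add hn hn1.le) hn.le
    have e : x n * (1 / x n + 1 / 2 + x n) = 1 + x n / 2 + x n ^ 2 := by field_simp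
    rw [e] at this
    rwa [mul_one_div] at this

section Near

variable {ε : ℕ → ℝ}

theorem tendsto_one_sub_extinctionProb_div (h0 : ∀ᶠ n in atTop, 0 < ε n)
    (hε : Tendsto ε atTop (𝓝 0)) :
    Tendsto (fun n => (1 - extinctionProb (1 + ε n)) / ε n) atTop (𝓝 2) := by
  have l1 : Tendsto (fun n => 1 / ((1 + ε n) * (1 / 2 + 2 * ε n))) atTop (𝓝 2) := by
    have := ((hε.const_add 1).mul ((hε.const_mul 2).const_add (1 / 2))).inv₀ (by norm_num)
    simpa using this
  have l2 : Tendsto (fun n => 2 / (1 + ε n)) atTop (𝓝 2) := by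
    simpa [div_eq_mul_inv] using ((hε.const_add 1).inv₀ (by norm_num)).const_mul 2
  refine tendsto_of_tendsto_of_tendsto_of_le_of_le' l1 l2 ?_ ?_
  · filter_upwards [h0, hε.eventually (gt_mem_nhds (show (0 : ℝ) < 1 / 2 by norm_num))] with n hn h2
    have := sub_one_le_mul_one_sub_extinctionProb (lam := 1 + ε n) (by linarith) (by linarith)
    rw [add_sub_cancel_left] at this
    rw [div_le_div_iff₀ (by positivity) hn]
    linarith
  · filter_upwards [h0] with n hn
    have := mul_one_sub_extinctionProb_le (lam := 1 + ε n) (by linarith)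
    rw [add_sub_cancel_left] at this
    rw [div_le_div_iff₀ hn (by positivity)]
    linarith

theorem tendsto_extinctionProb (h0 : ∀ᶠ n in atTop, 0 < ε n) (hε : Tendsto ε atTop (𝓝 0)) :
    Tendsto (fun n => extinctionProb (1 + ε n)) atTop (𝓝 1) := by
  have h := ((tendsto_one_sub_extinctionProb_div h0 hε).mul hε).const_sub 1
  rw [mul_zero, sub_zero] at h
  refine h.congr' ?_
  filter_upwards [h0] with n hn
  rw [div_mul_cancel₀ _ hn.ne']
  ring

theorem tendsto_one_sub_dualParam_div (h0 : ∀ᶠ n in atTop, 0 < ε n)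
    (hε : Tendsto ε atTop (𝓝 0)) :
    Tendsto (fun n => (1 - dualParam (1 + ε n)) / ε n) atTop (𝓝 1) := by
  have h := ((hε.const_add 1).mul (tendsto_one_sub_extinctionProb_div h0 hε)).sub_const 1
  rw [show ((1 : ℝ) + 0) * 2 - 1 = 1 by norm_num] at h
  refine h.congr' ?_
  filter_upwards [h0] with n hn
  rw [← mul_extinctionProb (show 1 < 1 + ε n by linarith)]
  field_simp
  ring

theorem tendsto_dualParam (h0 : ∀ᶠ n in atTop, 0 < ε n) (hε : Tendsto ε atTop (𝓝 0)) :
    Tendsto (fun n => dualParam (1 + ε n)) atTop (𝓝 1) := by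
  have h := (hε.const_add 1).mul (tendsto_extinctionProb h0 hε)
  rw [add_zero, mul_one] at h
  refine h.congr' ?_
  filter_upwards [h0] with n hn
  exact mul_extinctionProb (by linarith)

theorem tendsto_dualParam_rpow (h0 : ∀ᶠ n in atTop, 0 < ε n) (hε : Tendsto ε atTop (𝓝 0))
    {u : ℕ → ℝ} (hu : Tendsto (fun n => ε n * u n) atTop atTop) :
    Tendsto (fun n => dualParam (1 + ε n) ^ u n) atTop (𝓝 0) := by
  have h := hu.atTop_mul_pos one_pos (tendsto_one_sub_dualParam_div h0 hε)
  refine squeeze_zero' ?_ ?_ (Real.tendsto_exp_neg_atTop_nhds_zero.comp h)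
  · filter_upwards [h0] with n hn
    exact Real.rpow_nonneg (dualParam_pos (by linarith)).le _
  · filter_upwards [h0, hu.eventually_gt_atTop 0] with n hn hun
    have hd := dualParam_pos (show 1 < 1 + ε n by linarith)
    rw [Real.rpow_def_of_pos hd, Function.comp_apply, Real.exp_le_exp]
    have hu0 : 0 < u n := pos_of_mul_pos_right hun hn.le
    have e : ε n * u n * ((1 - dualParam (1 + ε n)) / ε n) =
        (1 - dualParam (1 + ε n)) * u n := by field_simp
    rw [e]
    nlinarith [Real.log_le_sub_one_of_pos hd]

end Near

/-- The slightly supercritical regime: `ω` gives the barrier `ω / ε` and `t` the excess time. -/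
structure Regime (ε ω t : ℕ → ℝ) : Prop where
  pos : ∀ᶠ n in atTop, 0 < ε n
  tendsto_zero : Tendsto ε atTop (𝓝 0)
  tendsto_barrier : Tendsto ω atTop atTop
  le_log : ∀ᶠ n in atTop, t n ≤ 100 * Real.log (ω n) / Real.log (1 + ε n)
  tendsto_mul : Tendsto (fun n => ε n * t n) atTop atTop

/-- The typical time at which a surviving process reaches the barrier. -/
def barrierTime (ε ω : ℕ → ℝ) (n : ℕ) : ℝ := Real.log (ω n) / Real.log (1 + ε n)

namespace Regime

variable {ε ω t : ℕ → ℝ} {τ : ℕ → ℕ}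

theorem eventually_le_half (H : Regime ε ω t) : ∀ᶠ n in atTop, 2 * ε n ≤ 1 := by
  filter_upwards [H.tendsto_zero.eventually (gt_mem_nhds (show (0 : ℝ) < 1 / 2 by norm_num))]
    with n hn
  linarith

theorem tendsto_mul_barrierTime (H : Regime ε ω t) : Tendsto (fun n => ε n * barrierTime ε ω n) atTop atTop := by
  refine tendsto_atTop_mono' _ ?_ (Real.tendsto_log_atTop.comp H.tendsto_barrier)
  filter_upwards [H.pos, H.tendsto_barrier.eventually_gt_atTop 1] with n hn hω
  have h1 : 0 < Real.log (1 + ε n) := Real.log_pos (by linarith)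
  have h2 : Real.log (1 + ε n) ≤ ε n := by
    have := Real.log_le_sub_one_of_pos (show 0 < 1 + ε n by linarith)
    linarith
  rw [Function.comp_apply, barrierTime, ← mul_div_assoc, le_div_iff₀ h1, mul_comm]
  exact mul_le_mul_of_nonneg_right h2 (Real.log_pos hω).le

theorem tendsto_of_tendsto_mul (H : Regime ε ω t) {u : ℕ → ℝ} (hu : Tendsto (fun n => ε n * u n) atTop atTop) :
    Tendsto u atTop atTop := by
  refine tendsto_atTop_mono' _ ?_ hu
  filter_upwards [H.pos, H.eventually_le_half, hu.eventually_gt_atTop 0] with n hn h2 hun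
  have hu0 : 0 < u n := pos_of_mul_pos_right hun hn.le
  nlinarith

theorem rpow_barrierTime (H : Regime ε ω t) : ∀ᶠ n in atTop, (1 + ε n) ^ barrierTime ε ω n = ω n := by
  filter_upwards [H.pos, H.tendsto_barrier.eventually_gt_atTop 1] with n hn hω
  have h1 : 0 < Real.log (1 + ε n) := Real.log_pos (by linarith)
  rw [Real.rpow_def_of_pos (by linarith), barrierTime, mul_div_cancel₀ _ h1.ne',
    Real.exp_log (by linarith)]

theorem tendsto_one_add (H : Regime ε ω t) : Tendsto (fun n => 1 + ε n) atTop (𝓝 1) := by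
  simpa using H.tendsto_zero.const_add 1

theorem tendsto_pow_floor_div (H : Regime ε ω t) :
    Tendsto (fun n => (1 + ε n) ^ ⌊barrierTime ε ω n⌋₊ / ω n) atTop (𝓝 1) := by
  have h := tendsto_rpow_div_rpow H.tendsto_one_add (C := 1)
    (x := fun n => (⌊barrierTime ε ω n⌋₊ : ℝ)) (y := barrierTime ε ω) (by
      filter_upwards [(H.tendsto_of_tendsto_mul H.tendsto_mul_barrierTime).eventually_ge_atTop 0]
        with n hn
      have h1 := Nat.floor_le hn
      have h2 := (Nat.lt_floor_add_one (barrierTime ε ω n)).le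
      rw [abs_le]; constructor <;> linarith)
  refine h.congr' ?_
  filter_upwards [H.rpow_barrierTime] with n hn
  rw [hn, Real.rpow_natCast]

theorem tendsto_pow_floor (H : Regime ε ω t) :
    Tendsto (fun n => (1 + ε n) ^ ⌊barrierTime ε ω n⌋₊) atTop atTop := by
  refine (H.tendsto_pow_floor_div.pos_mul_atTop one_pos H.tendsto_barrier).congr' ?_
  filter_upwards [H.tendsto_barrier.eventually_gt_atTop 0] with n hn
  field_simp

theorem tendsto_mul_div (H : Regime ε ω t) {θ : ℝ} : Tendsto (fun n => θ * ε n / ω n) atTop (𝓝 0) := by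
  have := (H.tendsto_zero.const_mul θ).mul H.tendsto_barrier.inv_tendsto_atTop
  simpa [div_eq_mul_inv] using this

theorem eventually_extinctionProb_lt_exp (H : Regime ε ω t) {θ : ℝ} :
    ∀ᶠ n in atTop, extinctionProb (1 + ε n) < Real.exp (-(θ * ε n / ω n)) := by
  have h1 := (tendsto_one_sub_extinctionProb_div H.pos H.tendsto_zero).eventually
    (lt_mem_nhds (show (1 : ℝ) < 2 by norm_num))
  filter_upwards [H.pos, h1, H.tendsto_barrier.eventually_gt_atTop (max θ 0)] with n hn h1 hω
  have hω0 : 0 < ω n := (le_max_right _ _).trans_lt hω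
  rw [lt_div_iff₀ hn, one_mul] at h1
  have h2 : θ * ε n / ω n ≤ ε n := by
    rw [div_le_iff₀ hω0, mul_comm]
    exact mul_le_mul_of_nonneg_left ((le_max_left _ _).trans hω.le) hn.le
  linarith [Real.one_sub_le_exp_neg (θ * ε n / ω n)]

/-- The growth phase: the generating function after about `barrierTime` steps. -/
theorem tendsto_growth (H : Regime ε ω t) {θ : ℝ} (hθ : 0 < θ) :
    Tendsto (fun n => ε n / (1 - (poissonPGF (1 + ε n))^[⌊barrierTime ε ω n⌋₊]
      (Real.exp (-(θ * ε n / ω n))))) atTop (𝓝 (1 / θ + 1 / 2)) := by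
  set m : ℕ → ℕ := fun n => ⌊barrierTime ε ω n⌋₊ with hm
  set s : ℕ → ℝ := fun n => Real.exp (-(θ * ε n / ω n)) with hs
  have l1 : Tendsto (fun n => ε n * (1 / (1 - s n)) / (1 + ε n) ^ m n) atTop (𝓝 (1 / θ)) := by
    have a1 := tendsto_div_one_sub_exp_neg (x := fun n => θ * ε n / ω n) (by
      filter_upwards [H.pos, H.tendsto_barrier.eventually_gt_atTop 0] with n h1 h2
      positivity) H.tendsto_mul_div
    have := (a1.div H.tendsto_pow_floor_div one_ne_zero).div_const θ
    rw [div_one] at this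
    refine this.congr' ?_
    filter_upwards [H.tendsto_barrier.eventually_gt_atTop 0] with n hω
    simp only [hs, hm, Pi.div_apply]
    field_simp
  have l2 : Tendsto (fun n => ε n * geomTail (1 + ε n) (m n) / (1 + ε n) ^ m n) atTop (𝓝 1) := by
    have := H.tendsto_one_add.mul (H.tendsto_pow_floor.inv_tendsto_atTop.const_sub 1)
    rw [sub_zero, mul_one] at this
    refine this.congr' ?_
    filter_upwards [H.pos] with n hn
    have : (1 + ε n) ^ m n ≠ 0 := by positivity
    simp only [geomTail, Pi.inv_apply]
    rw [show 1 - (1 + ε n) = -ε n by ring]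
    field_simp
    ring
  have u1 := l1.add (l2.const_mul (1 / 2))
  have u2 := l1.add (((H.tendsto_zero.const_mul 2).const_add (1 / 2)).mul l2)
  rw [mul_one] at u1
  rw [mul_zero, add_zero, mul_one] at u2
  have hev : ∀ᶠ n in atTop, 0 < ε n ∧
      1 / (1 - s n) + 1 / 2 * geomTail (1 + ε n) (m n) ≤
        (1 + ε n) ^ m n * (1 / (1 - (poissonPGF (1 + ε n))^[m n] (s n))) ∧
      (1 + ε n) ^ m n * (1 / (1 - (poissonPGF (1 + ε n))^[m n] (s n))) ≤
        1 / (1 - s n) + (1 / 2 + 2 * ε n) * geomTail (1 + ε n) (m n) := by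
    filter_upwards [H.pos, H.eventually_le_half, H.eventually_extinctionProb_lt_exp (θ := θ),
      H.tendsto_barrier.eventually_gt_atTop 0] with n hn h2 hq hω
    have hs1 : s n < 1 := Real.exp_lt_one_iff.2 (by
      rw [neg_lt_zero]; positivity)
    have := iterate_growth_bounds (lam := 1 + ε n) (by linarith) (by linarith) hq hs1 (m n)
    rw [add_sub_cancel_left] at this
    exact And.intro hn this
  refine tendsto_of_tendsto_of_tendsto_of_le_of_le' u1 u2 ?_ ?_
  · filter_upwards [hev] with n hn
    have hp : 0 < (1 + ε n) ^ m n := pow_pos (by linarith [hn.1]) _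
    rw [← mul_div_assoc (1 / 2 : ℝ), ← add_div, div_le_iff₀ hp]
    have := mul_le_mul_of_nonneg_left hn.2.1 hn.1.le
    rw [div_eq_mul_one_div (ε n)]
    linarith
  · filter_upwards [hev] with n hn
    have hp : 0 < (1 + ε n) ^ m n := pow_pos (by linarith [hn.1]) _
    rw [← mul_div_assoc (1 / 2 + 2 * ε n), ← add_div, le_div_iff₀ hp]
    have := mul_le_mul_of_nonneg_left hn.2.2 hn.1.le
    rw [div_eq_mul_one_div (ε n)]
    linarith

theorem abs_sub_rounding_le (H : Regime ε ω t)
    (hτ : ∀ n, τ n = ⌊barrierTime ε ω n + t n⌋₊ ∨ τ n = ⌈barrierTime ε ω n + t n⌉₊) :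
    ∀ᶠ n in atTop, |(τ n : ℝ) - (barrierTime ε ω n + t n)| ≤ 1 := by
  filter_upwards [(H.tendsto_of_tendsto_mul H.tendsto_mul_barrierTime).eventually_ge_atTop 0,
    (H.tendsto_of_tendsto_mul H.tendsto_mul).eventually_ge_atTop 0] with n h1 h2
  have h0 : 0 ≤ barrierTime ε ω n + t n := by linarith
  rw [abs_le]
  rcases hτ n with h | h <;> rw [h]
  · have := Nat.floor_le h0
    have := Nat.lt_floor_add_one (barrierTime ε ω n + t n)
    constructor <;> linarith
  · have := Nat.le_ceil (barrierTime ε ω n + t n)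
    have := Nat.ceil_lt_add_one h0
    constructor <;> linarith

theorem floor_le_rounding (H : Regime ε ω t)
    (hτ : ∀ n, τ n = ⌊barrierTime ε ω n + t n⌋₊ ∨ τ n = ⌈barrierTime ε ω n + t n⌉₊) : ∀ᶠ n in atTop, ⌊barrierTime ε ω n⌋₊ ≤ τ n := by
  filter_upwards [(H.tendsto_of_tendsto_mul H.tendsto_mul).eventually_ge_atTop 0] with n h2
  have h : ⌊barrierTime ε ω n⌋₊ ≤ ⌊barrierTime ε ω n + t n⌋₊ := Nat.floor_mono (by linarith)
  rcases hτ n with h' | h' <;> rw [h']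
  · exact h
  · exact h.trans (Nat.floor_le_ceil _)

theorem tendsto_dualParam_pow_div (H : Regime ε ω t)
    (hτ : ∀ n, τ n = ⌊barrierTime ε ω n + t n⌋₊ ∨ τ n = ⌈barrierTime ε ω n + t n⌉₊) :
    Tendsto (fun n => dualParam (1 + ε n) ^ (τ n - ⌊barrierTime ε ω n⌋₊) /
      dualParam (1 + ε n) ^ t n) atTop (𝓝 1) := by
  have h := tendsto_rpow_div_rpow (tendsto_dualParam H.pos H.tendsto_zero) (C := 2)
    (x := fun n => ((τ n - ⌊barrierTime ε ω n⌋₊ : ℕ) : ℝ)) (y := t) (by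
      filter_upwards [(H.tendsto_of_tendsto_mul H.tendsto_mul_barrierTime).eventually_ge_atTop 0,
        H.floor_le_rounding hτ, H.abs_sub_rounding_le hτ] with n hn h3 h4
      have h1 := Nat.floor_le hn
      have h2 := (Nat.lt_floor_add_one (barrierTime ε ω n)).le
      rw [Nat.cast_sub h3]
      rw [abs_le] at *
      constructor <;> linarith [h4.1, h4.2])
  simpa only [Real.rpow_natCast] using h

/-- The generating function of the generation size at the scale of the barrier. -/
theorem tendsto_iterate_sub_extinctionProb (H : Regime ε ω t)
    (hτ : ∀ n, τ n = ⌊barrierTime ε ω n + t n⌋₊ ∨ τ n = ⌈barrierTime ε ω n + t n⌉₊) {θ : ℝ} (hθ : 0 < θ) :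
    Tendsto (fun n => ((poissonPGF (1 + ε n))^[τ n] (Real.exp (-(θ * ε n / ω n))) -
      extinctionProb (1 + ε n)) / (4 * ε n * dualParam (1 + ε n) ^ t n)) atTop (𝓝 (1 / θ)) := by
  set m : ℕ → ℕ := fun n => ⌊barrierTime ε ω n⌋₊ with hm
  set k : ℕ → ℕ := fun n => τ n - m n with hk
  set d : ℕ → ℝ := fun n => dualParam (1 + ε n) with hd
  set q : ℕ → ℝ := fun n => extinctionProb (1 + ε n) with hq
  set y : ℕ → ℝ := fun n => (poissonPGF (1 + ε n))^[m n] (Real.exp (-(θ * ε n / ω n))) with hy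
  set w : ℕ → ℝ := fun n => (poissonPGF (1 + ε n))^[k n] (y n) - q n with hw
  have hθ' : (1 : ℝ) / θ + 1 / 2 ≠ 0 := by positivity
  have l0 : Tendsto (fun n => ε n / (y n - q n)) atTop (𝓝 ((2 + θ) / 4)) := by
    have a1 := (tendsto_one_sub_extinctionProb_div H.pos H.tendsto_zero).sub
      ((H.tendsto_growth hθ).inv₀ hθ')
    have e : 2 - (1 / θ + 1 / 2)⁻¹ = 4 / (2 + θ) := by field_simp; ring
    rw [e] at a1
    have a2 := a1.inv₀ (by positivity)
    rw [inv_div] at a2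
    refine a2.congr fun n => ?_
    rw [inv_div, ← sub_div, inv_div]
    congr 1
    simp only [hy, hq]
    ring
  have hpow0 : Tendsto (fun n => d n ^ k n) atTop (𝓝 0) := by
    have := (H.tendsto_dualParam_pow_div hτ).mul
      (tendsto_dualParam_rpow H.pos H.tendsto_zero H.tendsto_mul)
    rw [mul_zero] at this
    refine this.congr' ?_
    filter_upwards [H.pos] with n hn
    exact div_mul_cancel₀ _ (Real.rpow_pos_of_pos (dualParam_pos (by linarith)) _).ne'
  have hq1 := tendsto_extinctionProb H.pos H.tendsto_zero
  have l2 : Tendsto (fun n => ε n * geomTail (d n) (k n)) atTop (𝓝 1) := by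
    have := ((tendsto_dualParam H.pos H.tendsto_zero).mul (hpow0.const_sub 1)).div
      (tendsto_one_sub_dualParam_div H.pos H.tendsto_zero) one_ne_zero
    rw [sub_zero, mul_one, div_one] at this
    refine this.congr' ?_
    filter_upwards [H.pos] with n hn
    simp only [geomTail, Pi.div_apply, hd]
    rw [div_div_eq_mul_div]
    ring
  have lC : Tendsto (fun n => ε n * (d n ^ k n * (1 / w n))) atTop (𝓝 (θ / 4)) := by
    have u1 := l0.sub (((hq1.const_mul 2).inv₀ (by norm_num)).mul l2)
    have u2 := l0.sub ((((H.tendsto_zero.const_mul 2).const_sub (1 / 2)).div hq1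
      one_ne_zero).mul l2)
    rw [show (2 + θ) / 4 - (2 * 1)⁻¹ * 1 = θ / 4 by ring] at u1
    rw [show (2 + θ) / 4 - (1 / 2 - 2 * 0) / 1 * 1 = θ / 4 by ring] at u2
    have hev : ∀ᶠ n in atTop, 0 < ε n ∧
        1 / (y n - q n) - 1 / (2 * q n) * geomTail (d n) (k n) ≤ d n ^ k n * (1 / w n) ∧
        d n ^ k n * (1 / w n) ≤
          1 / (y n - q n) - (1 / 2 - 2 * ε n) / q n * geomTail (d n) (k n) := by
      filter_upwards [H.pos, H.eventually_le_half, H.eventually_extinctionProb_lt_exp (θ := θ),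
        H.tendsto_barrier.eventually_gt_atTop 0] with n hn h2 hqs hω
      have hs1 : Real.exp (-(θ * ε n / ω n)) < 1 := Real.exp_lt_one_iff.2 (by
        rw [neg_lt_zero]; positivity)
      have hl : 1 < 1 + ε n := by linarith
      have := iterate_decay_bounds (lam := 1 + ε n) hl (by linarith)
        (extinctionProb_lt_iterate hl hqs (m n)) (iterate_poissonPGF_lt_one hl hs1 (m n)) (k n)
      rw [add_sub_cancel_left] at this
      exact And.intro hn this
    refine tendsto_of_tendsto_of_tendsto_of_le_of_le' u1 u2 ?_ ?_
    · filter_upwards [hev] with n hn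
      have := mul_le_mul_of_nonneg_left hn.2.1 hn.1.le
      refine le_of_eq_of_le ?_ this
      simp only [hy, hq, hd]
      ring
    · filter_upwards [hev] with n hn
      have := mul_le_mul_of_nonneg_left hn.2.2 hn.1.le
      refine this.trans_eq ?_
      simp only [hy, hq, hd, Pi.div_apply]
      ring
  have lF := ((H.tendsto_dualParam_pow_div hτ).div lC (by positivity)).div_const 4
  rw [show 1 / (θ / 4) / 4 = 1 / θ by field_simp] at lF
  refine lF.congr' ?_
  filter_upwards [H.pos, H.floor_le_rounding hτ, H.eventually_extinctionProb_lt_exp (θ := θ)]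
    with n hn hle hqs
  have hl : 1 < 1 + ε n := by linarith
  have hτn : τ n = k n + m n := (Nat.sub_add_cancel hle).symm
  have hw0 : 0 < w n := sub_pos.2
    (extinctionProb_lt_iterate hl (extinctionProb_lt_iterate hl hqs (m n)) (k n))
  have hd0 : 0 < d n := dualParam_pos hl
  have hdt : 0 < d n ^ t n := Real.rpow_pos_of_pos hd0 _
  rw [hτn, Function.iterate_add_apply]
  change d n ^ k n / d n ^ t n / (ε n * (d n ^ k n * (1 / w n))) / 4 =
    w n / (4 * ε n * d n ^ t n)
  field_simp

/-- The processes that die out contribute a negligible amount. -/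
theorem tendsto_extinctionProb_sub_iterate (H : Regime ε ω t)
    (hτ : ∀ n, τ n = ⌊barrierTime ε ω n + t n⌋₊ ∨ τ n = ⌈barrierTime ε ω n + t n⌉₊) :
    Tendsto (fun n => (extinctionProb (1 + ε n) - (poissonPGF (1 + ε n))^[τ n] 0) /
      (4 * ε n * dualParam (1 + ε n) ^ t n)) atTop (𝓝 0) := by
  have hd1 := tendsto_dualParam H.pos H.tendsto_zero
  have hq1 := tendsto_extinctionProb H.pos H.tendsto_zero
  have ha := tendsto_rpow_div_rpow hd1 (H.abs_sub_rounding_le hτ)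
  simp only [Real.rpow_natCast] at ha
  have h1 := tendsto_dualParam_rpow H.pos H.tendsto_zero H.tendsto_mul_barrierTime
  have ht := tendsto_dualParam_rpow H.pos H.tendsto_zero H.tendsto_mul
  have hτ0 : Tendsto (fun n => dualParam (1 + ε n) ^ τ n) atTop (𝓝 0) := by
    have := (ha.mul h1).mul ht
    rw [mul_zero] at this
    refine this.congr' ?_
    filter_upwards [H.pos] with n hn
    have hd0 := dualParam_pos (show 1 < 1 + ε n by linarith)
    rw [Real.rpow_add hd0]
    have := (Real.rpow_pos_of_pos hd0 (t n)).ne'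
    have := (Real.rpow_pos_of_pos hd0 (barrierTime ε ω n)).ne'
    field_simp
  have hlim := (ha.mul h1).mul (((hq1.const_mul 2).mul
    (tendsto_one_sub_dualParam_div H.pos H.tendsto_zero)).div
      ((hd1.mul (hτ0.const_sub 1)).const_mul 4) (by norm_num))
  rw [mul_zero, zero_mul] at hlim
  refine squeeze_zero' ?_ ?_ hlim
  · filter_upwards [H.pos] with n hn
    have hl : 1 < 1 + ε n := by linarith
    have := Real.rpow_pos_of_pos (dualParam_pos hl) (t n)
    exact div_nonneg (sub_nonneg.2 (iterate_lt_extinctionProb hl (extinctionProb_pos hl) _).le)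
      (by positivity)
  · have hτpos : ∀ᶠ n in atTop, τ n ≠ 0 := by
      filter_upwards [H.abs_sub_rounding_le hτ,
        (H.tendsto_of_tendsto_mul H.tendsto_mul_barrierTime).eventually_gt_atTop 1,
        (H.tendsto_of_tendsto_mul H.tendsto_mul).eventually_ge_atTop 0] with n h1 h2 h3 h0
      rw [h0, abs_le, Nat.cast_zero] at h1
      linarith [h1.1]
    filter_upwards [H.pos, hτpos] with n hn hne
    have hl : 1 < 1 + ε n := by linarith
    have hd0 := dualParam_pos hl
    have hdt := Real.rpow_pos_of_pos hd0 (t n)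
    have hdt1 := Real.rpow_pos_of_pos hd0 (barrierTime ε ω n)
    have hk1 : 0 < 1 - dualParam (1 + ε n) ^ τ n := by
      linarith [pow_lt_one₀ hd0.le (dualParam_lt_one hl) hne]
    refine (div_le_div_of_nonneg_right (extinctionProb_sub_iterate_le hl (τ n) hne)
      (by positivity)).trans_eq ?_
    simp only [Pi.div_apply]
    rw [Real.rpow_add hd0]
    field_simp

/-- The probability of a large drop below the barrier is negligible. -/
theorem tendsto_extinctionProb_rpow_div (H : Regime ε ω t) {η : ℝ} (hη : 0 < η) :
    Tendsto (fun n => extinctionProb (1 + ε n) ^ (η * (ω n / ε n)) /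
      dualParam (1 + ε n) ^ t n) atTop (𝓝 0) := by
  have hlog : Tendsto (fun x : ℝ => η * x - 200 * Real.log x) atTop atTop := by
    have h := Real.isLittleO_log_id_atTop.bound (show 0 < η / 400 by positivity)
    refine tendsto_atTop_mono' _ ?_ (tendsto_id.const_mul_atTop (show 0 < η / 2 by positivity))
    filter_upwards [h, eventually_gt_atTop 1] with x hx h1
    rw [id, Real.norm_of_nonneg (Real.log_pos h1).le, Real.norm_of_nonneg (by linarith)] at hx
    rw [id]
    linarith
  have hlim := Real.tendsto_exp_neg_atTop_nhds_zero.comp (hlog.comp H.tendsto_barrier)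
  have hp := (tendsto_one_sub_extinctionProb_div H.pos H.tendsto_zero).eventually
    (lt_mem_nhds (show (1 : ℝ) < 2 by norm_num))
  have hr : ∀ᶠ n in atTop,
      (1 - dualParam (1 + ε n)) / ε n * (1 + ε n) / dualParam (1 + ε n) < 2 :=
    (((tendsto_one_sub_dualParam_div H.pos H.tendsto_zero).mul H.tendsto_one_add).div
      (tendsto_dualParam H.pos H.tendsto_zero) one_ne_zero).eventually
      (gt_mem_nhds (by norm_num))
  refine squeeze_zero' ?_ ?_ hlim
  · filter_upwards [H.pos] with n hn
    have hl : 1 < 1 + ε n := by linarith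
    have h1 := Real.rpow_pos_of_pos (dualParam_pos hl) (t n)
    have h2 := Real.rpow_pos_of_pos (extinctionProb_pos hl) (η * (ω n / ε n))
    positivity
  · filter_upwards [H.pos, hp, hr, H.le_log, H.tendsto_barrier.eventually_gt_atTop 1,
      (H.tendsto_of_tendsto_mul H.tendsto_mul).eventually_ge_atTop 0] with n hn hp hr hle hω ht
    have hl : 1 < 1 + ε n := by linarith
    have hd0 := dualParam_pos hl
    have hq0 := extinctionProb_pos hl
    have hlogω : 0 < Real.log (ω n) := Real.log_pos hω
    rw [Function.comp_apply, Function.comp_apply, Real.rpow_def_of_pos hd0,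
      Real.rpow_def_of_pos hq0, ← Real.exp_sub, Real.exp_le_exp]
    have a1 : Real.log (extinctionProb (1 + ε n)) * (η * (ω n / ε n)) ≤ -(η * ω n) := by
      rw [lt_div_iff₀ hn, one_mul] at hp
      have b1 : Real.log (extinctionProb (1 + ε n)) ≤ -ε n := by
        linarith [Real.log_le_sub_one_of_pos hq0]
      have b2 := mul_le_mul_of_nonneg_right b1 (show 0 ≤ η * (ω n / ε n) by positivity)
      refine b2.trans_eq ?_
      field_simp
    have a2 : -Real.log (dualParam (1 + ε n)) * t n ≤ 200 * Real.log (ω n) := by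
      have b1 : -Real.log (dualParam (1 + ε n)) ≤
          (1 - dualParam (1 + ε n)) / dualParam (1 + ε n) := by
        have := Real.one_sub_inv_le_log_of_pos hd0
        rw [sub_div, one_div, div_self hd0.ne']
        linarith
      have b2 : ε n / (1 + ε n) ≤ Real.log (1 + ε n) := by
        have := Real.one_sub_inv_le_log_of_pos (show 0 < 1 + ε n by linarith)
        refine le_of_eq_of_le ?_ this
        field_simp
        ring
      have b3 : t n ≤ 100 * Real.log (ω n) / (ε n / (1 + ε n)) :=
        hle.trans (div_le_div_of_nonneg_left (by positivity) (by positivity) b2)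
      have b4 : 0 ≤ (1 - dualParam (1 + ε n)) / dualParam (1 + ε n) :=
        div_nonneg (by linarith [dualParam_lt_one hl]) hd0.le
      calc _ ≤ (1 - dualParam (1 + ε n)) / dualParam (1 + ε n) *
            (100 * Real.log (ω n) / (ε n / (1 + ε n))) := by gcongr
        _ = (1 - dualParam (1 + ε n)) / ε n * (1 + ε n) / dualParam (1 + ε n) *
            (100 * Real.log (ω n)) := by field_simp
        _ ≤ 2 * (100 * Real.log (ω n)) := by gcongr
        _ = _ := by ring
    linarith

end Regime

/-! ### The generation sizes near the barrier -/

theorem setIntegral_pos_pow_genSize {lam : ℝ} (hlam : 0 ≤ lam) (r : ℕ) {s : ℝ} (h0 : 0 ≤ s)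
    (h1 : s ≤ 1) :
    ∫ ξ in {ξ | 0 < genSize ξ r}, s ^ genSize ξ r ∂(poissonGW lam) =
      (poissonPGF lam)^[r] s - (poissonPGF lam)^[r] 0 := by
  have hS : MeasurableSet {ξ | 0 < genSize ξ r} := measurableSet_genSize r (Set.Ioi 0)
  rw [← integral_pow_genSize hlam r h0 h1, ← integral_pow_genSize hlam r le_rfl zero_le_one,
    ← integral_sub (integrable_pow_genSize lam h0 h1 r)
      (integrable_pow_genSize lam le_rfl zero_le_one r), ← integral_indicator hS]
  congr with ξ
  by_cases h : genSize ξ r = 0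
  · simp [h]
  · simp [h, Nat.pos_of_ne_zero h]

namespace Regime

variable {ε ω t : ℕ → ℝ} {τ : ℕ → ℕ}

theorem eventually_normalization_pos (H : Regime ε ω t) :
    ∀ᶠ n in atTop, 0 < 4 * ε n * dualParam (1 + ε n) ^ t n := by
  filter_upwards [H.pos] with n hn
  have := Real.rpow_pos_of_pos (dualParam_pos (show 1 < 1 + ε n by linarith)) (t n)
  positivity

theorem tendsto_measureReal_pos_lt (H : Regime ε ω t)
    (hτ : ∀ n, τ n = ⌊barrierTime ε ω n + t n⌋₊ ∨ τ n = ⌈barrierTime ε ω n + t n⌉₊)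
    {c : ℝ} (hc : 0 < c) :
    Tendsto (fun n => (poissonGW (1 + ε n)).real
        {ξ | 0 < genSize ξ (τ n) ∧ (genSize ξ (τ n) : ℝ) < c * (ω n / ε n)} /
      (4 * ε n * dualParam (1 + ε n) ^ t n)) atTop (𝓝 c) := by
  set U : ℕ → (ℕ × ℕ → ℕ) → ℝ := fun n ξ => Real.exp (-|ε n / ω n|) ^ genSize ξ (τ n) with hUdef
  have hU1 : ∀ n ξ, U n ξ ∈ Set.Icc (0 : ℝ) 1 := fun n ξ =>
    ⟨by positivity, pow_le_one₀ (Real.exp_pos _).le (Real.exp_le_one_iff.2 (by simp))⟩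
  have hU : ∀ n, Measurable (U n) := fun n =>
    (measurable_from_nat (f := fun k => Real.exp (-|ε n / ω n|) ^ k)).comp (measurable_genSize _)
  have hmom : ∀ k : ℕ, Tendsto (fun n => (∫ ξ, U n ξ ^ (k + 1)
      ∂((poissonGW (1 + ε n)).restrict {ξ | 0 < genSize ξ (τ n)})) /
      (4 * ε n * dualParam (1 + ε n) ^ t n)) atTop (𝓝 (1 / ((k : ℝ) + 1))) := by
    intro k
    have h := (H.tendsto_iterate_sub_extinctionProb hτ (θ := (k : ℝ) + 1) (by positivity)).add
      (H.tendsto_extinctionProb_sub_iterate hτ)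
    rw [add_zero] at h
    refine h.congr' ?_
    filter_upwards [H.pos, H.tendsto_barrier.eventually_gt_atTop 0] with n hn hω
    have he : ∀ ξ, U n ξ ^ (k + 1) =
        Real.exp (-(((k : ℝ) + 1) * ε n / ω n)) ^ genSize ξ (τ n) := fun ξ => by
      simp only [hUdef]
      rw [abs_of_pos (by positivity), ← pow_mul, mul_comm, pow_mul, ← Real.exp_nat_mul]
      congr 2
      push_cast
      ring
    simp_rw [he]
    rw [setIntegral_pos_pow_genSize (by linarith) _ (Real.exp_pos _).le
      (Real.exp_le_one_iff.2 (by rw [neg_nonpos]; positivity)), ← add_div]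
    congr 1
    ring
  have key := tendsto_measureReal_lt_of_tendsto_moments hU hU1 H.eventually_normalization_pos hmom
    (Real.exp_pos (-c)) (Real.exp_lt_one_iff.2 (by linarith))
  rw [Real.log_exp, neg_neg] at key
  refine key.congr' ?_
  filter_upwards [H.pos, H.tendsto_barrier.eventually_gt_atTop 0] with n hn hω
  rw [measureReal_restrict_apply (measurableSet_lt measurable_const (hU n))]
  congr 2
  ext ξ
  simp only [Set.mem_inter_iff, Set.mem_ofPred_eq, hUdef]
  rw [abs_of_pos (by positivity), ← Real.exp_nat_mul, Real.exp_lt_exp, and_comm,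
    mul_neg, neg_lt_neg_iff, ← mul_div_assoc, ← mul_div_assoc, div_lt_iff₀ hω, lt_div_iff₀ hn]

theorem tendsto_measureReal_survives_pos_lt (H : Regime ε ω t)
    (hτ : ∀ n, τ n = ⌊barrierTime ε ω n + t n⌋₊ ∨ τ n = ⌈barrierTime ε ω n + t n⌉₊) :
    Tendsto (fun n => (poissonGW (1 + ε n)).real
        {ξ | Survives ξ ∧ 0 < genSize ξ (τ n) ∧ (genSize ξ (τ n) : ℝ) < ω n / ε n} /
      (4 * ε n * dualParam (1 + ε n) ^ t n)) atTop (𝓝 1) := by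
  have h1 := H.tendsto_measureReal_pos_lt hτ one_pos
  simp only [one_mul] at h1
  have h2 := h1.sub (H.tendsto_extinctionProb_sub_iterate hτ)
  rw [sub_zero] at h2
  refine tendsto_of_tendsto_of_tendsto_of_le_of_le' h2 h1 ?_ ?_
  · filter_upwards [H.pos, H.eventually_normalization_pos] with n hn hb
    have hl : 1 < 1 + ε n := by linarith
    rw [← sub_div]
    refine div_le_div_of_nonneg_right ?_ hb.le
    rw [← measureReal_not_survives_inter_pos (by linarith) (tendsto_iterate_poissonPGF_zero hl),
      sub_le_iff_le_add]
    refine (measureReal_mono fun ξ hξ => ?_).trans (measureReal_union_le _ _)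
    by_cases h : Survives ξ
    · exact Or.inl ⟨h, hξ⟩
    · exact Or.inr ⟨h, hξ.1⟩
  · filter_upwards [H.eventually_normalization_pos] with n hb
    exact div_le_div_of_nonneg_right (measureReal_mono fun ξ hξ => hξ.2) hb.le

theorem tendsto_measureReal_drop (H : Regime ε ω t) {η : ℝ} (hη : 0 < η) (τ : ℕ → ℕ) :
    Tendsto (fun n => (poissonGW (1 + ε n)).real
        {ξ | (∃ j ≤ τ n, ω n / ε n ≤ (genSize ξ j : ℝ)) ∧
          (genSize ξ (τ n) : ℝ) < (1 - η) * (ω n / ε n)} /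
      (4 * ε n * dualParam (1 + ε n) ^ t n)) atTop (𝓝 0) := by
  have hp := tendsto_one_sub_extinctionProb_div H.pos H.tendsto_zero
  have hlim := ((H.tendsto_extinctionProb_rpow_div hη).mul hp).div_const 2
  rw [zero_mul, zero_div] at hlim
  have hq : ∀ᶠ n in atTop, extinctionProb (1 + ε n) ^ (ω n / ε n) ≤ 1 / 2 := by
    filter_upwards [H.pos, hp.eventually (lt_mem_nhds (show (1 : ℝ) < 2 by norm_num)),
      H.tendsto_barrier.eventually_gt_atTop 1] with n hn hpn hω
    have hq0 := extinctionProb_pos (show 1 < 1 + ε n by linarith)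
    rw [lt_div_iff₀ hn, one_mul] at hpn
    rw [Real.rpow_def_of_pos hq0]
    have h1 : Real.log (extinctionProb (1 + ε n)) ≤ -ε n := by
      linarith [Real.log_le_sub_one_of_pos hq0]
    have h2 : Real.log (extinctionProb (1 + ε n)) * (ω n / ε n) ≤ -1 := by
      have := mul_le_mul_of_nonneg_right h1 (show 0 ≤ ω n / ε n by positivity)
      rw [neg_mul, mul_div_cancel₀ _ hn.ne'] at this
      linarith
    refine (Real.exp_le_exp.2 h2).trans ?_
    rw [Real.exp_neg, one_div]
    exact inv_anti₀ two_pos (by linarith [Real.add_one_le_exp 1])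
  refine squeeze_zero' ?_ ?_ hlim
  · filter_upwards [H.eventually_normalization_pos] with n hb
    exact div_nonneg measureReal_nonneg hb.le
  · filter_upwards [H.pos, H.tendsto_barrier.eventually_gt_atTop 0, hq] with n hn hω hq
    have hl : 1 < 1 + ε n := by linarith
    have hq0 := extinctionProb_pos hl
    have hq1 := extinctionProb_lt_one hl
    have hdt := Real.rpow_pos_of_pos (dualParam_pos hl) (t n)
    have h1 := measureReal_exists_le_and_lt_le (by linarith) hq0 hq1
      (poissonPGF_extinctionProb hl) (M := ω n / ε n) (by positivity)
      ((1 - η) * (ω n / ε n)) (τ n)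
    rw [show ω n / ε n - (1 - η) * (ω n / ε n) = η * (ω n / ε n) by ring] at h1
    have h2 : (1 - extinctionProb (1 + ε n)) / (1 - extinctionProb (1 + ε n) ^ (ω n / ε n)) ≤
        2 * (1 - extinctionProb (1 + ε n)) := by
      rw [div_le_iff₀ (by linarith)]
      nlinarith
    have h3 := h1.trans (mul_le_mul_of_nonneg_left h2 (Real.rpow_pos_of_pos hq0 _).le)
    refine (div_le_div_of_nonneg_right h3 (by positivity)).trans_eq ?_
    field_simp
    ring

theorem pos_lt_of_isFirstPassage {ξ : ℕ × ℕ → ℕ} {M : ℝ} (hM : 0 < M) {T r : ℕ}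
    (hT : IsFirstPassage ξ M T) (hr : r < T) : 0 < genSize ξ r ∧ (genSize ξ r : ℝ) < M := by
  constructor
  · by_contra h0
    have h1 := genSize_eq_zero_of_le hr.le (Nat.eq_zero_of_not_pos h0)
    have h2 : M ≤ (genSize ξ T : ℝ) := hT.1
    rw [h1, Nat.cast_zero] at h2
    linarith
  · by_contra h0
    exact absurd (hT.2 (not_lt.1 h0)) (not_le.2 hr)

theorem tendsto_measureReal_firstPassage (H : Regime ε ω t) :
    Tendsto (fun n => (poissonGW (1 + ε n)).real
        {ξ | ∃ T : ℕ, IsFirstPassage ξ (ω n / ε n) T ∧ barrierTime ε ω n + t n < (T : ℝ)} /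
      (4 * ε n * dualParam (1 + ε n) ^ t n)) atTop (𝓝 1) := by
  set τ : ℕ → ℕ := fun n => ⌊barrierTime ε ω n + t n⌋₊ with hτdef
  have hτ : ∀ n, τ n = ⌊barrierTime ε ω n + t n⌋₊ ∨ τ n = ⌈barrierTime ε ω n + t n⌉₊ :=
    fun n => Or.inl rfl
  have hnonneg : ∀ᶠ n in atTop, 0 ≤ barrierTime ε ω n + t n := by
    filter_upwards [(H.tendsto_of_tendsto_mul H.tendsto_mul_barrierTime).eventually_ge_atTop 0,
      (H.tendsto_of_tendsto_mul H.tendsto_mul).eventually_ge_atTop 0] with n h1 h2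
    linarith
  rw [tendsto_order]
  constructor
  · intro y hy
    obtain ⟨η, hη0, hη1, hηy⟩ : ∃ η : ℝ, 0 < η ∧ η < 1 ∧ y < 1 - η :=
      ⟨min ((1 - y) / 2) (1 / 2), lt_min (by linarith) (by norm_num),
        (min_le_right _ _).trans_lt (by norm_num), by
          linarith [min_le_left ((1 - y) / 2) (1 / 2)]⟩
    have h1 := ((H.tendsto_measureReal_pos_lt hτ (c := 1 - η) (by linarith)).sub
      (H.tendsto_extinctionProb_sub_iterate hτ)).sub (H.tendsto_measureReal_drop hη0 τ)
    rw [sub_zero, sub_zero] at h1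
    filter_upwards [h1.eventually (lt_mem_nhds hηy), H.pos, H.eventually_normalization_pos,
      H.tendsto_barrier.eventually_gt_atTop 0] with n hyn hn hb hω
    refine hyn.trans_le ?_
    have hl : 1 < 1 + ε n := by linarith
    have hl0 : 0 ≤ 1 + ε n := by linarith
    have hlim := tendsto_iterate_poissonPGF_zero hl
    rw [← sub_div, ← sub_div]
    refine div_le_div_of_nonneg_right ?_ hb.le
    rw [← measureReal_not_survives_inter_pos hl0 hlim, sub_le_iff_le_add, sub_le_iff_le_add]
    have h0 := measureReal_forall_pos_lt_eq_zero hl0 (extinctionProb_pos hl)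
      (extinctionProb_lt_one hl).le (poissonPGF_extinctionProb hl) hlim (ω n / ε n)
    rw [← add_zero ((poissonGW (1 + ε n)).real
      {ξ | ∃ T : ℕ, IsFirstPassage ξ (ω n / ε n) T ∧ barrierTime ε ω n + t n < (T : ℝ)}), ← h0]
    refine (measureReal_mono fun ξ hξ => ?_).trans ((measureReal_union_le _ _).trans
      (add_le_add_left ((measureReal_union_le _ _).trans
        (add_le_add_left (measureReal_union_le _ _) _)) _))
    by_cases hs : Survives ξ
    swap
    · exact Or.inr ⟨hs, hξ.1⟩
    refine Or.inl ?_
    by_cases hj : ∃ j ≤ τ n, ω n / ε n ≤ (genSize ξ j : ℝ)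
    · exact Or.inr ⟨hj, hξ.2⟩
    refine Or.inl ?_
    by_cases hr : ∃ r, ω n / ε n ≤ (genSize ξ r : ℝ)
    · refine Or.inl ⟨sInf {r | ω n / ε n ≤ (genSize ξ r : ℝ)},
        ⟨Nat.sInf_mem hr, fun r hr => Nat.sInf_le hr⟩, ?_⟩
      refine Nat.lt_of_floor_lt (not_le.1 fun hle => hj ⟨_, hle, Nat.sInf_mem hr⟩)
    · push Not at hr
      exact Or.inr fun r => ⟨hs r, hr r⟩
  · intro y hy
    have h1 := H.tendsto_measureReal_pos_lt hτ one_pos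
    simp only [one_mul] at h1
    filter_upwards [h1.eventually (gt_mem_nhds hy), H.pos, H.eventually_normalization_pos,
      H.tendsto_barrier.eventually_gt_atTop 0, hnonneg] with n hyn hn hb hω h0
    refine lt_of_le_of_lt (div_le_div_of_nonneg_right (measureReal_mono ?_) hb.le) hyn
    rintro ξ ⟨T, hT, hlt⟩
    exact pos_lt_of_isFirstPassage (by positivity) hT ((Nat.floor_lt h0).2 hlt)

theorem tendsto_measureReal_forall_pos_lt (H : Regime ε ω t) :
    Tendsto (fun n => (poissonGW (1 + ε n)).real
        {ξ | ∀ r : ℕ, (r : ℝ) ≤ barrierTime ε ω n + t n →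
          0 < genSize ξ r ∧ (genSize ξ r : ℝ) < ω n / ε n} /
      (4 * ε n * dualParam (1 + ε n) ^ t n)) atTop (𝓝 1) := by
  have h1 := H.tendsto_measureReal_pos_lt (τ := fun n => ⌊barrierTime ε ω n + t n⌋₊)
    (fun n => Or.inl rfl) one_pos
  simp only [one_mul] at h1
  refine tendsto_of_tendsto_of_tendsto_of_le_of_le' H.tendsto_measureReal_firstPassage h1 ?_ ?_
  · filter_upwards [H.pos, H.eventually_normalization_pos,
      H.tendsto_barrier.eventually_gt_atTop 0] with n hn hb hω
    refine div_le_div_of_nonneg_right (measureReal_mono ?_) hb.le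
    rintro ξ ⟨T, hT, hlt⟩ r hr
    exact pos_lt_of_isFirstPassage (by positivity) hT (by exact_mod_cast hr.trans_lt hlt)
  · filter_upwards [(H.tendsto_of_tendsto_mul H.tendsto_mul_barrierTime).eventually_ge_atTop 0,
      (H.tendsto_of_tendsto_mul H.tendsto_mul).eventually_ge_atTop 0,
      H.eventually_normalization_pos] with n h1 h2 hb
    exact div_le_div_of_nonneg_right (measureReal_mono fun ξ hξ =>
      hξ _ (Nat.floor_le (by linarith))) hb.le

end Regime

end

theorem mainTheorem6
    (ε ω t : ℕ → ℝ)
    (hε_pos : ∀ᶠ n in atTop, 0 < ε n)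
    (hε : Tendsto ε atTop (𝓝 0))
    (hω : Tendsto ω atTop atTop)
    (ht : ∀ᶠ n in atTop, t n ≤ 100 * Real.log (ω n) / Real.log (1 + ε n))
    (hεt : Tendsto (fun n => ε n * t n) atTop atTop)
    (t₁ : ℕ → ℝ)
    (ht₁ : ∀ n, t₁ n = Real.log (ω n) / Real.log (1 + ε n))
    -- `τ n` is the (possibly non-integer) time `t₁ n + t n` rounded down or up
    (τ : ℕ → ℕ)
    (hτ : ∀ n, τ n = ⌊t₁ n + t n⌋₊ ∨ τ n = ⌈t₁ n + t n⌉₊) :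
    ((fun n => (poissonGW (1 + ε n)).real
        {ξ | ∃ T : ℕ, IsFirstPassage ξ (ω n / ε n) T ∧ t₁ n + t n < (T : ℝ)})
      ~[atTop] fun n => 4 * ε n * dualParam (1 + ε n) ^ t n) ∧
    ((fun n => (poissonGW (1 + ε n)).real
        {ξ | ∀ r : ℕ, (r : ℝ) ≤ t₁ n + t n →
          0 < genSize ξ r ∧ (genSize ξ r : ℝ) < ω n / ε n})
      ~[atTop] fun n => 4 * ε n * dualParam (1 + ε n) ^ t n) ∧
    ((fun n => (poissonGW (1 + ε n)).real
        {ξ | 0 < genSize ξ (τ n) ∧ (genSize ξ (τ n) : ℝ) < ω n / ε n})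
      ~[atTop] fun n => 4 * ε n * dualParam (1 + ε n) ^ t n) ∧
    ((fun n => (poissonGW (1 + ε n)).real
        {ξ | Survives ξ ∧ 0 < genSize ξ (τ n) ∧ (genSize ξ (τ n) : ℝ) < ω n / ε n})
      ~[atTop] fun n => 4 * ε n * dualParam (1 + ε n) ^ t n) := by
  obtain rfl : t₁ = barrierTime ε ω := funext ht₁
  have H : Regime ε ω t := ⟨hε_pos, hε, hω, ht, hεt⟩
  have hne : ∀ᶠ n in atTop, 4 * ε n * dualParam (1 + ε n) ^ t n ≠ 0 :=
    H.eventually_normalization_pos.mono fun n hn => hn.ne'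
  have h3 := H.tendsto_measureReal_pos_lt hτ one_pos
  simp only [one_mul] at h3
  exact ⟨(isEquivalent_iff_tendsto_one hne).2 H.tendsto_measureReal_firstPassage,
    (isEquivalent_iff_tendsto_one hne).2 H.tendsto_measureReal_forall_pos_lt,
    (isEquivalent_iff_tendsto_one hne).2 h3,
    (isEquivalent_iff_tendsto_one hne).2 (H.tendsto_measureReal_survives_pos_lt hτ)⟩
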